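/- Let $r\neq -1$ be a rational number that is not a square, and let $\overline{\mathbf Q}$ be an algebraic closure of $\mathbf Q$. For $n\ge 1$ put $R_n=\{x\in\overline{\mathbf Q}^*: x^n\in\langle r\rangle\}$ and $F_n=\mathbf Q(R_n)=\mathbf Q(\zeta_n,\sqrt[n]{r})$; put $R_\infty=\bigcup_{n\ge1}R_n$, $F_\infty=\mathbf Q(R_\infty)$ and, for $p$ prime, $R_{p^\infty}=\bigcup_{k\ge 1}R_{p^k}$. For a subgroup $R\subset\overline{\mathbf Q}^*$ let $\mathrm{Aut}_{R\cap\mathbf Q^*}(R)$ be the group of automorphisms of the group $R$ that are the identity on $R\cap\mathbf Q^*$. Let $A=\mathrm{Aut}_{R_\infty\cap\mathbf Q^*}(R_\infty)$, a compact group for the topology of pointwise convergence on the discrete group $R_\infty$, with Haar measure $\nu$ normalized by $\nu(A)=1$, and let $G\subset A$ be the image of the injection $\mathrm{Gal}(F_\infty/\mathbf Q)\to A$ given by the action on $R_\infty$. For $p$ prime let $A_p=\mathrm{Aut}_{R_{p^\infty}\cap\mathbf Q^*}(R_{p^\infty})$, so that $A=\prod_p A_p$ via restriction, let $\varphi_p:A_p\to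 \mathrm{Aut}_{R_p\cap\mathbf Q^*}(R_p)$ be the restriction map, and put $S_p=A_p\setminus\ker\varphi_p$. Let $S=\prod_p S_p\subset A$ be the Artin set, and for $T\subset A$ measurable put $\delta(T)=\nu(G\cap T)/\nu(G)$. Then the product $$A(r)=\prod_{p\text{ prime}}\Bigl(1-\frac1{[F_p:\mathbf Q]}\Bigr)$$ converges, $\nu(S)=A(r)$, and $$\delta(S)=\frac{\nu(G\cap S)}{\nu(G)}=E(r)\cdot A(r),$$ where, with $D=\mathrm{disc}(\mathbf Q(\sqrt r))$, the factor is $E(r)=1$ if $D$ is even, and $$E(r)=1-\prod_{p\mid D}\frac{-1}{[F_p:\mathbf Q]-1}$$ if $D$ is odd. Moreover, there is a largest integer $h$ for which $r$ is an $h$-th power in $\mathbf Q^*$, and with this $h$ $$A(r)=\prod_{p\mid h}\Bigl(1-\frac1{p-1}\Bigr)\cdot\prod_{p\nmid h}\Bigl(1-\frac1{p(p-1)}\Bigr),$$ where the products are over primes and the second one converges; and if $D$ is odd, then $E(r)$ is Hooley's correction factor $$E(r)=1-\prod_{p\mid D,\ p\mid h}\frac{-1}{p-2}\cdot\prod_{p\mid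 D,\ p\nmid h}\frac{-1}{p^2-p-1}.$$ -/

import Mathlib

open MeasureTheory

noncomputable section

namespace ArtinEntanglement

/-- A fixed algebraic closure of `ℚ`. -/
abbrev Qbar : Type := AlgebraicClosure ℚ

/-- `Qbar` is an algebraic closure of `ℚ` for its canonical structure of `ℚ`-algebra. -/
instance : IsAlgClosure ℚ Qbar := by
  have h : (DivisionRing.toRatAlgebra : Algebra ℚ (AlgebraicClosure ℚ)) =
      AlgebraicClosure.instAlgebra ℚ := Subsingleton.elim _ _
  have hz : ∀ inst : Algebra ℚ (AlgebraicClosure ℚ), AlgebraicClosure.instAlgebra ℚ = inst →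
      @Algebra.IsAlgebraic ℚ (AlgebraicClosure ℚ) _ _ inst := by
    rintro _ rfl
    exact AlgebraicClosure.isAlgebraic ℚ
  exact ⟨inferInstance, hz _ h.symm⟩

instance : Algebra.IsAlgebraic ℚ Qbar := IsAlgClosure.isAlgebraic

/-- The embedding `ℚ* → Qbar*`. -/
def ratUnits : ℚˣ →* Qbarˣ := Units.map (algebraMap ℚ Qbar : ℚ →* Qbar)

/-- The subgroup `⟨r⟩` of `Qbar*`. -/
def base (r : ℚˣ) : Subgroup Qbarˣ := Subgroup.zpowers (ratUnits r)

/-! ### Groups of radicals -/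

/-- `R_n`, the group of `x ∈ Qbar*` with `x ^ n ∈ ⟨r⟩`. -/
def rad (r : ℚˣ) (n : ℕ) : Subgroup Qbarˣ where
  carrier := {x | x ^ n ∈ base r}
  mul_mem' := fun {x y} hx hy => by
    simpa only [Set.mem_ofPred_eq, mul_pow] using (base r).mul_mem hx hy
  one_mem' := by simpa only [Set.mem_ofPred_eq, one_pow] using (base r).one_mem
  inv_mem' := fun {x} hx => by
    simpa only [Set.mem_ofPred_eq, inv_pow] using (base r).inv_mem hx

/-- `R_{p^∞}`, the union of the groups `R_{p^k}`. -/
def radPrimePow (r : ℚˣ) (p : ℕ) : Subgroup Qbarˣ where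
  carrier := {x | ∃ k : ℕ, x ∈ rad r (p ^ k)}
  mul_mem' := by
    rintro x y ⟨k, hk⟩ ⟨l, hl⟩
    refine ⟨k + l, (rad r _).mul_mem ?_ ?_⟩
    · change x ^ p ^ (k + l) ∈ base r
      rw [pow_add, pow_mul]
      exact (base r).pow_mem hk _
    · change y ^ p ^ (k + l) ∈ base r
      rw [add_comm, pow_add, pow_mul]
      exact (base r).pow_mem hl _
  one_mem' := ⟨0, (rad r _).one_mem⟩
  inv_mem' := by
    rintro x ⟨k, hk⟩
    exact ⟨k, (rad r _).inv_mem hk⟩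

/-- `R_∞`, the union of all the groups `R_n` with `n ≥ 1`. -/
def radInf (r : ℚˣ) : Subgroup Qbarˣ where
  carrier := {x | ∃ k : ℕ, 0 < k ∧ x ∈ rad r k}
  mul_mem' := by
    rintro x y ⟨k, hk0, hk⟩ ⟨l, hl0, hl⟩
    refine ⟨k * l, Nat.mul_pos hk0 hl0, (rad r _).mul_mem ?_ ?_⟩
    · change x ^ (k * l) ∈ base r
      rw [pow_mul]
      exact (base r).pow_mem hk _
    · change y ^ (k * l) ∈ base r
      rw [mul_comm, pow_mul]
      exact (base r).pow_mem hl _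
  one_mem' := ⟨1, one_pos, (rad r _).one_mem⟩
  inv_mem' := by
    rintro x ⟨k, hk0, hk⟩
    exact ⟨k, hk0, (rad r _).inv_mem hk⟩

theorem rad_le_radPrimePow (r : ℚˣ) (p : ℕ) : rad r p ≤ radPrimePow r p :=
  fun _ hx => ⟨1, by rwa [pow_one]⟩

theorem radPrimePow_le_radInf (r : ℚˣ) {p : ℕ} (hp : 0 < p) : radPrimePow r p ≤ radInf r :=
  fun _ ⟨k, hk⟩ => ⟨p ^ k, pow_pos hp k, hk⟩

theorem base_le_range (r : ℚˣ) : base r ≤ ratUnits.range := by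
  rw [base, Subgroup.zpowers_le]
  exact ⟨r, rfl⟩

/-! ### Automorphism groups of radicals -/

/-- `Aut_{R ∩ ℚ*}(R)`: the group automorphisms of `R` that are the identity on `R ∩ ℚ*`. -/
def radAut (R : Subgroup Qbarˣ) : Subgroup (MulAut R) where
  carrier := {a | ∀ x : R, (x : Qbarˣ) ∈ ratUnits.range → a x = x}
  mul_mem' := fun {a b} ha hb x hx => by
    rw [MulAut.mul_apply, hb x hx, ha x hx]
  one_mem' := fun _ _ => rfl
  inv_mem' := fun {a} ha x hx => by
    have h := congrArg (a⁻¹ : MulAut R) (ha x hx)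
    rw [MulAut.inv_apply_self] at h
    exact h.symm

/-- An element of `Aut_{R ∩ ℚ*}(R)` fixes `x ^ n` if this is an element of `⟨r⟩`. -/
theorem radAut_pow_mem {r : ℚˣ} {R : Subgroup Qbarˣ} {a : MulAut R} (ha : a ∈ radAut R) (x : R)
    {n : ℕ} (hx : (x : Qbarˣ) ∈ rad r n) : ((a x : R) : Qbarˣ) ∈ rad r n := by
  have h : a (x ^ n) = x ^ n := ha (x ^ n) (base_le_range r hx)
  rw [map_pow] at h
  change ((a x : R) : Qbarˣ) ^ n ∈ base r
  rw [← Subgroup.coe_pow, h]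
  exact hx

/-- Restriction `Aut_{R ∩ ℚ*}(R) → Aut_{R' ∩ ℚ*}(R')` to a stable subgroup `R'` of `R`. -/
def restrictAut {R' R : Subgroup Qbarˣ} (h : R' ≤ R)
    (hs : ∀ a ∈ radAut R, ∀ x : R, (x : Qbarˣ) ∈ R' → ((a x : R) : Qbarˣ) ∈ R') :
    radAut R →* radAut R' where
  toFun a :=
    ⟨{ toFun := fun x => ⟨a.1 ⟨x, h x.2⟩, hs a.1 a.2 _ x.2⟩
       invFun := fun x => ⟨(a⁻¹).1 ⟨x, h x.2⟩, hs _ (a⁻¹).2 _ x.2⟩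
       left_inv := fun x => Subtype.ext <| by
         change (((a.1)⁻¹ (a.1 ⟨x, h x.2⟩) : R) : Qbarˣ) = x
         rw [MulAut.inv_apply_self]
       right_inv := fun x => Subtype.ext <| by
         change ((a.1 ((a.1)⁻¹ ⟨x, h x.2⟩) : R) : Qbarˣ) = x
         rw [MulAut.apply_inv_self]
       map_mul' := fun x y => Subtype.ext <| by
         change ((a.1 (⟨x, h x.2⟩ * ⟨y, h y.2⟩) : R) : Qbarˣ) = _
         rw [map_mul]
         rfl },
     fun x hx => Subtype.ext (congrArg (fun t : R => (t : Qbarˣ)) (a.2 ⟨x, h x.2⟩ hx))⟩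
  map_one' := rfl
  map_mul' _ _ := rfl

/-- The group `A = Aut_{R_∞ ∩ ℚ*}(R_∞)`. -/
abbrev A (r : ℚˣ) : Type := radAut (radInf r)

/-- The group `A_p = Aut_{R_{p^∞} ∩ ℚ*}(R_{p^∞})`. -/
abbrev Aloc (r : ℚˣ) (p : ℕ) : Type := radAut (radPrimePow r p)

/-- The group `A(n) = Aut_{R_n ∩ ℚ*}(R_n)`. -/
abbrev Afin (r : ℚˣ) (n : ℕ) : Type := radAut (rad r n)

/-- The projection `A → A_p` of the decomposition `A = ∏_p A_p`: restriction to `R_{p^∞}`. -/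
def proj (r : ℚˣ) (p : Nat.Primes) : A r →* Aloc r p :=
  restrictAut (radPrimePow_le_radInf r p.2.pos)
    fun _ ha x ⟨k, hk⟩ => ⟨k, radAut_pow_mem ha x hk⟩

/-- The restriction map `φ_p : A_p → A(p)`. -/
def phi (r : ℚˣ) (p : ℕ) : Aloc r p →* Afin r p :=
  restrictAut (rad_le_radPrimePow r p) fun _ ha x hx => radAut_pow_mem ha x hx

/-- `S_p = A_p \ ker φ_p`. -/
def Sloc (r : ℚˣ) (p : ℕ) : Set (Aloc r p) := {a | a ∉ (phi r p).ker}

/-- The Artin set `S = ∏_p S_p`, as a subset of `A = ∏_p A_p`. -/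
def artinSet (r : ℚˣ) : Set (A r) := {a | ∀ p : Nat.Primes, proj r p a ∈ Sloc r p}

/-! ### Topology and Haar measure on `A` -/

/-- The topology of pointwise convergence on the discrete group `R`. -/
instance radAutTopology (R : Subgroup Qbarˣ) : TopologicalSpace (radAut R) :=
  TopologicalSpace.induced (fun a (x : R) => a.1 x)
    (@Pi.topologicalSpace R (fun _ => R) fun _ => ⊥)

theorem isOpen_eval (R : Subgroup Qbarˣ) (x y : R) : IsOpen {a : radAut R | a.1 x = y} := by
  let _ : TopologicalSpace R := ⊥
  have _ : DiscreteTopology R := ⟨rfl⟩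
  have hc : Continuous fun a : radAut R => a.1 x :=
    (continuous_apply (A := fun _ : R => R) x).comp continuous_induced_dom
  exact (isOpen_discrete {y}).preimage hc

theorem continuous_to_radAut {R : Subgroup Qbarˣ} {X : Type*} [TopologicalSpace X]
    (f : X → radAut R) (h : ∀ x y : R, IsOpen {t | (f t).1 x = y}) : Continuous f := by
  let _ : TopologicalSpace R := ⊥
  have _ : DiscreteTopology R := ⟨rfl⟩
  refine continuous_induced_rng.2 (continuous_pi fun x => ?_)
  exact continuous_discrete_rng.2 fun y => h x y

instance (R : Subgroup Qbarˣ) : IsTopologicalGroup (radAut R) where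
  continuous_mul := by
    refine continuous_to_radAut _ fun x y => ?_
    have : {t : radAut R × radAut R | (t.1 * t.2).1 x = y} =
        ⋃ z : R, {a : radAut R | a.1 z = y} ×ˢ {b : radAut R | b.1 x = z} := by
      ext t
      simp [MulAut.mul_apply]
    rw [this]
    exact isOpen_iUnion fun z => (isOpen_eval R z y).prod (isOpen_eval R x z)
  continuous_inv := by
    refine continuous_to_radAut _ fun x y => ?_
    have : {t : radAut R | (t⁻¹).1 x = y} = {a : radAut R | a.1 y = x} := by
      ext t
      change (t.1)⁻¹ x = y ↔ t.1 y = x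
      constructor
      · rintro rfl
        exact MulAut.apply_inv_self _ _ _
      · rintro rfl
        exact MulAut.inv_apply_self _ _ _
    rw [this]
    exact isOpen_eval R y x

theorem finite_pow_eq (R : Subgroup Qbarˣ) {k : ℕ} (hk : 0 < k) (x : R) :
    {y : R | y ^ k = x ^ k}.Finite := by
  have hf : {z : Qbar | z ^ k = ((x : Qbarˣ) : Qbar) ^ k}.Finite := by
    have h0 : (Polynomial.X ^ k - Polynomial.C (((x : Qbarˣ) : Qbar) ^ k)) ≠ 0 :=
      Polynomial.X_pow_sub_C_ne_zero hk _
    refine (Multiset.finite_toSet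
      (Polynomial.X ^ k - Polynomial.C (((x : Qbarˣ) : Qbar) ^ k)).roots).subset fun z hz => ?_
    have hz' : z ^ k = ((x : Qbarˣ) : Qbar) ^ k := hz
    change z ∈ Polynomial.roots _
    rw [Polynomial.mem_roots h0, Polynomial.IsRoot.def]
    simp [hz']
  refine Set.Finite.of_finite_image (f := fun y : R => ((y : Qbarˣ) : Qbar))
    (hf.subset ?_) ?_
  · rintro _ ⟨y, hy, rfl⟩
    have h := congrArg (fun t : R => ((t : Qbarˣ) : Qbar)) hy
    simpa using h
  · intro a _ b _ hab
    exact Subtype.ext (Units.ext hab)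

instance (r : ℚˣ) : CompactSpace (A r) := by
  let _ : TopologicalSpace (radInf r) := ⊥
  have _ : DiscreteTopology (radInf r) := ⟨rfl⟩
  have hk : ∀ x : radInf r, ∃ k : ℕ, 0 < k ∧ ((x ^ k : radInf r) : Qbarˣ) ∈ ratUnits.range := by
    rintro ⟨x, k, hk0, hk⟩
    exact ⟨k, hk0, base_le_range r hk⟩
  choose k hk0 hk using hk
  let T : radInf r → Set (radInf r) := fun x => {y | y ^ k x = x ^ k x}
  have hT : ∀ x, (T x).Finite := fun x => finite_pow_eq _ (hk0 x) x
  let ev : A r → radInf r → radInf r := fun a x => a.1 x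
  have hind : Topology.IsInducing ev := ⟨rfl⟩
  have hrange : Set.range ev = (Set.univ.pi T) ∩ ((⋂ x : radInf r, ⋂ y : radInf r, {f | f (x * y) = f x * f y}) ∩
      ((⋂ x : radInf r, ⋂ (_ : (x : Qbarˣ) ∈ ratUnits.range), {f | f x = x}) ∩
        ⋂ x : radInf r, ⋂ (_ : x ≠ 1), {f | f x ≠ 1})) := by
    ext f
    simp only [Set.mem_range, Set.mem_inter_iff, Set.mem_pi, Set.mem_univ, true_implies,
      Set.mem_iInter, Set.mem_ofPred_eq]
    constructor
    · rintro ⟨a, rfl⟩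
      refine ⟨fun x => ?_, fun x y => map_mul a.1 x y, fun x hx => a.2 x hx, fun x hx h => ?_⟩
      · change a.1 x ^ k x = x ^ k x
        rw [← map_pow]
        exact a.2 _ (hk x)
      · exact hx ((map_eq_one_iff a.1 a.1.injective).1 h)
    · rintro ⟨hfT, hmul, hfix, hinj⟩
      let F : radInf r →* radInf r := MonoidHom.mk' f hmul
      have hFinj : Function.Injective F := by
        rw [injective_iff_map_eq_one]
        intro x hx
        by_contra hne
        exact hinj x hne hx
      have hFsurj : Function.Surjective F := by
        intro y
        have hmaps : Set.MapsTo F (T y) (T y) := by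
          intro x hx
          have hx' : x ^ k y = y ^ k y := hx
          change F x ^ k y = y ^ k y
          rw [← map_pow, hx']
          exact hfix _ (hk y)
        obtain ⟨x, -, hx⟩ := Set.surj_on_of_inj_on_of_ncard_le (s := T y) (t := T y)
          (fun a _ => F a) (fun a ha => hmaps ha) (fun a b _ _ hab => hFinj hab) le_rfl (hT y) y
          (show y ∈ T y from rfl)
        exact ⟨x, hx.symm⟩
      exact ⟨⟨MulEquiv.ofBijective F ⟨hFinj, hFsurj⟩, fun x hx => hfix x hx⟩, rfl⟩
  have hclosed : ∀ (x : radInf r) (s : Set (radInf r)),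
      IsClosed {f : radInf r → radInf r | f x ∈ s} :=
    fun x s => (isClosed_discrete s).preimage (continuous_apply x)
  refine ⟨hind.isCompact_iff.2 ?_⟩
  rw [Set.image_univ, hrange]
  refine (isCompact_univ_pi fun x => (hT x).isCompact).inter_right ?_
  refine IsClosed.inter ?_ (IsClosed.inter ?_ ?_)
  · exact isClosed_iInter fun x => isClosed_iInter fun y =>
      isClosed_eq (continuous_apply (A := fun _ : radInf r => radInf r) (x * y))
        ((continuous_of_discreteTopology (f := fun q : radInf r × radInf r => q.1 * q.2)).comp
          ((continuous_apply (A := fun _ : radInf r => radInf r) x).prodMk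
            (continuous_apply (A := fun _ : radInf r => radInf r) y)))
  · exact isClosed_iInter fun x => isClosed_iInter fun _ => hclosed x {x}
  · exact isClosed_iInter fun x => isClosed_iInter fun _ => hclosed x {1}ᶜ

instance (r : ℚˣ) : MeasurableSpace (A r) := borel _

instance (r : ℚˣ) : BorelSpace (A r) := ⟨rfl⟩

/-- The Haar measure `ν` on the compact group `A`, normalized by `ν(A) = 1`. -/
def nu (r : ℚˣ) : Measure (A r) := Measure.haarMeasure ⊤

/-! ### The Galois group -/

/-- The field `ℚ(R)` generated by a group of radicals. -/
def radField (R : Subgroup Qbarˣ) : IntermediateField ℚ Qbar :=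
  IntermediateField.adjoin ℚ ((fun x : Qbarˣ => (x : Qbar)) '' R)

/-- `F_n = ℚ(R_n) = ℚ(ζ_n, r^{1/n})`. -/
abbrev F (r : ℚˣ) (n : ℕ) : IntermediateField ℚ Qbar := radField (rad r n)

/-- `F_∞ = ℚ(R_∞)`. -/
abbrev Finf (r : ℚˣ) : IntermediateField ℚ Qbar := radField (radInf r)

/-- The inclusion of `R_∞` in the multiplicative group of `F_∞`. -/
def toFinf (r : ℚˣ) : radInf r →* (Finf r)ˣ :=
  MonoidHom.toHomUnits
    { toFun := fun x => ⟨((x : Qbarˣ) : Qbar), IntermediateField.subset_adjoin _ _ ⟨x, x.2, rfl⟩⟩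
      map_one' := rfl
      map_mul' := fun _ _ => rfl }

/-- The inclusion `F_∞* → Qbar*`. -/
def ofFinf (r : ℚˣ) : (Finf r)ˣ →* Qbarˣ := Units.map ((Finf r).val : Finf r →* Qbar)

/-- The image `σ(x)` of a radical `x ∈ R_∞` under a field automorphism `σ` of `F_∞`. -/
def galApply (r : ℚˣ) (σ : Gal(Finf r/ℚ)) : radInf r →* Qbarˣ :=
  (ofFinf r).comp ((Units.map (σ : Finf r →* Finf r)).comp (toFinf r))

theorem coe_galApply (r : ℚˣ) (σ : Gal(Finf r/ℚ)) (x : radInf r) :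
    ((galApply r σ x : Qbarˣ) : Qbar) = ((σ (toFinf r x : Finf r) : Finf r) : Qbar) := rfl

theorem galApply_of_rat (r : ℚˣ) (σ : Gal(Finf r/ℚ)) (x : radInf r)
    (hx : (x : Qbarˣ) ∈ ratUnits.range) : galApply r σ x = x := by
  obtain ⟨q, hq⟩ := hx
  refine Units.ext ?_
  have h : (toFinf r x : Finf r) = algebraMap ℚ (Finf r) q := by
    refine Subtype.ext ?_
    change ((x : Qbarˣ) : Qbar) = algebraMap ℚ Qbar q
    rw [← hq]
    rfl
  rw [coe_galApply, h, AlgEquiv.commutes, ← h]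
  rfl

theorem galApply_mem (r : ℚˣ) (σ : Gal(Finf r/ℚ)) (x : radInf r) :
    galApply r σ x ∈ radInf r := by
  obtain ⟨k, hk0, hk⟩ := x.2
  refine ⟨k, hk0, ?_⟩
  change galApply r σ x ^ k ∈ base r
  rw [← map_pow, galApply_of_rat r σ (x ^ k) (base_le_range r hk)]
  exact hk

/-- The natural map `Gal(F_∞/ℚ) → A` given by the action of the Galois group on `R_∞`. -/
def galRep (r : ℚˣ) : Gal(Finf r/ℚ) →* A r where
  toFun σ :=
    ⟨{ toFun := fun x => ⟨galApply r σ x, galApply_mem r σ x⟩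
       invFun := fun x => ⟨galApply r σ⁻¹ x, galApply_mem r σ⁻¹ x⟩
       left_inv := fun x => Subtype.ext <| Units.ext <| by
         change ((σ⁻¹ (σ (toFinf r x : Finf r)) : Finf r) : Qbar) = _
         rw [← AlgEquiv.mul_apply, inv_mul_cancel]
         rfl
       right_inv := fun x => Subtype.ext <| Units.ext <| by
         change ((σ (σ⁻¹ (toFinf r x : Finf r)) : Finf r) : Qbar) = _
         rw [← AlgEquiv.mul_apply, mul_inv_cancel]
         rfl
       map_mul' := fun x y => Subtype.ext (map_mul (galApply r σ) x y) },
     fun x hx => Subtype.ext (galApply_of_rat r σ x hx)⟩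
  map_one' := rfl
  map_mul' _ _ := rfl

/-- The Galois group `G`, as a subgroup of `A`. -/
def G (r : ℚˣ) : Subgroup (A r) := (galRep r).range

/-- The fraction `δ(S) = ν(G ∩ S) / ν(G)`. -/
def density (r : ℚˣ) (S : Set (A r)) : ℝ :=
  (nu r).real ((G r : Set (A r)) ∩ S) / (nu r).real (G r : Set (A r))

/-! ### The constants -/

/-- `A(r) = ∏_p (1 - 1 / [F_p : ℚ])`. -/
def artinConstant (r : ℚˣ) : ℝ :=
  ∏' p : Nat.Primes, (1 - 1 / (Module.finrank ℚ (F r p) : ℝ))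

/-- The field `ℚ(√r)`. -/
def sqrtField (r : ℚˣ) : IntermediateField ℚ Qbar :=
  IntermediateField.adjoin ℚ {x : Qbar | x ^ 2 = algebraMap ℚ Qbar r}

instance (r : ℚˣ) : NumberField (sqrtField r) where
  to_finiteDimensional := by
    have hfin : {x : Qbar | x ^ 2 = algebraMap ℚ Qbar r}.Finite := by
      have h0 : (Polynomial.X ^ 2 - Polynomial.C (algebraMap ℚ Qbar r)) ≠ 0 :=
        Polynomial.X_pow_sub_C_ne_zero two_pos _
      refine (Multiset.finite_toSet
        (Polynomial.X ^ 2 - Polynomial.C (algebraMap ℚ Qbar r)).roots).subset fun z hz => ?_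
      have hz' : z ^ 2 = algebraMap ℚ Qbar r := hz
      change z ∈ Polynomial.roots _
      rw [Polynomial.mem_roots h0, Polynomial.IsRoot.def]
      simp [hz']
    have _ : Finite {x : Qbar | x ^ 2 = algebraMap ℚ Qbar r} := hfin
    exact IntermediateField.finiteDimensional_adjoin fun x _ => Algebra.IsIntegral.isIntegral x

/-- The discriminant `D` of `ℚ(√r)`. -/
def disc (r : ℚˣ) : ℤ := NumberField.discr (sqrtField r)

/-- The correction factor `E(r)`: it is `1` if `D` is even, and
`1 - ∏_{p ∣ D} (-1 / ([F_p : ℚ] - 1))` if `D` is odd. -/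
def correctionFactor (r : ℚˣ) : ℝ :=
  open scoped Classical in
  if Even (disc r) then 1
  else 1 - ∏ p ∈ (disc r).natAbs.primeFactors, (-1) / ((Module.finrank ℚ (F r p) : ℝ) - 1)

end ArtinEntanglement

end

/-!
The Artin set and the Galois group are described through the subgroups `K_p` of `A` of elements
that are trivial on `R_p` (`radFixer`) and their finite intersections `K_T` (`finsetFixer`):
the Artin set is the intersection of the complements of all the `K_p`. Inclusion-exclusion
(`measureReal_inter_biInter_compl`) and a limit over finite sets `T` of primes reduce the theorem to
the indices of `K_T` in `A` and of `G ∩ K_T` in `G`.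

* The `p`-component of an element of `A` is again an element of `A` (`exists_component`). Hence the
  index of `K_T` is the product of the indices of the `K_p` (`index_finsetFixer`), and the finite
  products of the factors `1 - 1 / [A : K_p]` converge to `ν(S)`.
* The index of `G ∩ K_T` in `G` is that of `K_T` in `A`, divided by that of `G K_T` in `A`. The
  latter is `1` unless `D` is odd and `T` contains `2` and the primes dividing `D`, in which
  case it is `2` (`G_sup_finsetFixer`, `index_G_sup_finsetFixer`). For `T = {p}` this also
  gives `[A : K_p] = [F_p : ℚ]`.

To see how far `G` is from `A`, write `|r| = ρ ^ h` with `h` maximal and `β ^ 2 = ρ`. If `x ∈ R_∞`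
lies in a cyclotomic field, then `x` is a root of unity times a power of `β` (`apply_eq_of_abelian`):
after multiplication by a root of unity, `x` is fixed by a Galois element that inverts roots of
unity, so that its conjugates are `x` and `-x`. By Kummer theory, an element of `A` that fixes `β`
and the roots of unity comes from the Galois group (`exists_absRep_inv_mul_mem_radFixer`). As every
element of `A` acts on roots of unity as an element of `G`, the index of `G` is at most two
(`G_index`); in particular `ν(G)` is positive.

An element of `A` that moves `β` and fixes enough roots of unity may be replaced by its
`2`-component, which lies in `K_p` for all odd `p`. If it moves `√r`, it agrees on `R_2` with an
element of `G` that lies in `K_p` for the odd `p ∈ T`, provided `√r` is not in the field of the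
`p`-th roots of unity for these `p`. By ramification and Gauss sums, `√r` is in this field
exactly if `D` is odd and its prime divisors are in `T` (`disc_of_sqrt_fixed`,
`sqrt_fixed_of_odd_disc`); the parity condition uses `D ≡ 0, 1 mod 4` (`discr_quadratic`).
-/

noncomputable section

namespace ArtinEntanglement

variable {r : ℚˣ}

/-! ### The absolute Galois group acting on radicals -/

theorem radInf_ext {x y : radInf r} (h : ((x : Qbarˣ) : Qbar) = ((y : Qbarˣ) : Qbar)) : x = y :=
  Subtype.ext (Units.ext h)

/-- The field generated by a Galois-stable group of radicals is normal over `ℚ`. -/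
theorem normal_radField {R : Subgroup Qbarˣ}
    (hR : ∀ (σ : Gal(Qbar/ℚ)), ∀ x ∈ R, Units.map (σ : Qbar →* Qbar) x ∈ R) :
    Normal ℚ (radField R) := by
  refine IntermediateField.normal_iff_forall_map_le'.2 fun σ => ?_
  rw [radField, IntermediateField.adjoin_map]
  refine IntermediateField.adjoin.mono _ _ _ ?_
  rintro _ ⟨_, ⟨x, hx, rfl⟩, rfl⟩
  exact ⟨_, hR σ x hx, rfl⟩

theorem map_ratUnits (σ : Gal(Qbar/ℚ)) (q : ℚˣ) :
    Units.map (σ : Qbar →* Qbar) (ratUnits q) = ratUnits q :=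
  Units.ext (σ.commutes q)

theorem map_mem_rad (σ : Gal(Qbar/ℚ)) {n : ℕ} {x : Qbarˣ} (hx : x ∈ rad r n) :
    Units.map (σ : Qbar →* Qbar) x ∈ rad r n := by
  obtain ⟨q, hq⟩ := base_le_range r hx
  change _ ^ n ∈ base r
  rw [← map_pow, ← hq, map_ratUnits, hq]
  exact hx

theorem map_mem_radInf (σ : Gal(Qbar/ℚ)) {x : Qbarˣ} (hx : x ∈ radInf r) :
    Units.map (σ : Qbar →* Qbar) x ∈ radInf r := by
  obtain ⟨k, hk0, hk⟩ := hx
  exact ⟨k, hk0, map_mem_rad σ hk⟩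

instance (r : ℚˣ) : Normal ℚ (Finf r) := normal_radField fun σ _ hx => map_mem_radInf σ hx

instance (r : ℚˣ) (n : ℕ) : Normal ℚ (F r n) := normal_radField fun σ _ hx => map_mem_rad σ hx

/-- The action of the absolute Galois group of `ℚ` on `R_∞`. -/
def absRep (r : ℚˣ) : Gal(Qbar/ℚ) →* A r :=
  (galRep r).comp (AlgEquiv.restrictNormalHom (Finf r))

theorem coe_absRep (σ : Gal(Qbar/ℚ)) (x : radInf r) :
    (((absRep r σ).1 x : Qbarˣ) : Qbar) = σ ((x : Qbarˣ) : Qbar) :=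
  AlgEquiv.restrictNormal_commutes σ (Finf r) (toFinf r x : Finf r)

theorem range_absRep (r : ℚˣ) : (absRep r).range = G r := by
  rw [absRep, G, MonoidHom.range_comp,
    MonoidHom.range_eq_top.2 (AlgEquiv.restrictNormalHom_surjective Qbar), MonoidHom.range_eq_map]

theorem absRep_mem_G (σ : Gal(Qbar/ℚ)) : absRep r σ ∈ G r := by
  rw [← range_absRep]
  exact ⟨σ, rfl⟩

/-! ### Pointwise stabilizers in `A` -/

/-- The subgroup of `A` of elements that fix every element of `s`. -/
def fixer (r : ℚˣ) (s : Set (radInf r)) : Subgroup (A r) where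
  carrier := {a | ∀ x ∈ s, a.1 x = x}
  mul_mem' := fun {a b} ha hb x hx => by
    change a.1 (b.1 x) = x
    rw [hb x hx, ha x hx]
  one_mem' := fun _ _ => rfl
  inv_mem' := fun {a} ha x hx => by
    have h := congrArg ((a.1)⁻¹ : MulAut (radInf r)) (ha x hx)
    rw [MulAut.inv_apply_self] at h
    exact h.symm

theorem mem_fixer {s : Set (radInf r)} {a : A r} : a ∈ fixer r s ↔ ∀ x ∈ s, a.1 x = x := Iff.rfl

theorem mul_apply (a b : A r) (x : radInf r) : (a * b).1 x = a.1 (b.1 x) := rfl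

theorem inv_apply_eq (a : A r) (x y : radInf r) : (a⁻¹).1 x = y ↔ x = a.1 y := by
  constructor
  · rintro rfl
    exact (MulAut.apply_inv_self _ a.1 x).symm
  · rintro rfl
    exact MulAut.inv_apply_self _ a.1 y

theorem normal_fixer {s : Set (radInf r)} (hs : ∀ (a : A r), ∀ x ∈ s, a.1 x ∈ s) :
    (fixer r s).Normal where
  conj_mem a ha g x hx := by
    rw [mul_apply, mul_apply, ha _ (hs g⁻¹ x hx)]
    exact ((inv_apply_eq g x _).1 rfl).symm

theorem isClosed_fixer (s : Set (radInf r)) : IsClosed (fixer r s : Set (A r)) := by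
  have : (fixer r s : Set (A r)) = ⋂ x ∈ s, {a : A r | a.1 x = x} := by
    ext a
    simp [mem_fixer]
  rw [this]
  refine isClosed_biInter fun x _ => ?_
  rw [← isOpen_compl_iff]
  have : {a : A r | a.1 x = x}ᶜ = ⋃ y ∈ {y : radInf r | y ≠ x}, {a : A r | a.1 x = y} := by
    ext a
    simp
  rw [this]
  exact isOpen_biUnion fun y _ => isOpen_eval _ x y

/-- The elements of `A` that fix the `M`-th roots of unity. -/
abbrev rootFixer (r : ℚˣ) (M : ℕ) : Subgroup (A r) := fixer r {u | u ^ M = 1}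

/-- The elements of `A` that fix the group `R_n`. -/
abbrev radFixer (r : ℚˣ) (n : ℕ) : Subgroup (A r) := fixer r {x | (x : Qbarˣ) ∈ rad r n}

instance (M : ℕ) : (rootFixer r M).Normal := normal_fixer fun a x hx => by
  change a.1 x ^ M = 1
  rw [← map_pow, show x ^ M = 1 from hx, map_one]

instance (n : ℕ) : (radFixer r n).Normal := normal_fixer fun a x hx => radAut_pow_mem a.2 x hx

theorem rootFixer_anti {M N : ℕ} (h : M ∣ N) : rootFixer r N ≤ rootFixer r M := by
  intro a ha x hx
  obtain ⟨k, rfl⟩ := h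
  refine ha x ?_
  change x ^ (M * k) = 1
  rw [pow_mul, show x ^ M = 1 from hx, one_pow]

theorem rad_mono {m n : ℕ} (h : m ∣ n) : rad r m ≤ rad r n := by
  intro x hx
  obtain ⟨k, rfl⟩ := h
  change x ^ (m * k) ∈ base r
  rw [pow_mul]
  exact (base r).pow_mem hx k

theorem radFixer_anti {M N : ℕ} (h : M ∣ N) : radFixer r N ≤ radFixer r M :=
  fun _ ha x hx => ha x (rad_mono h hx)

theorem radFixer_le_rootFixer (n : ℕ) : radFixer r n ≤ rootFixer r n := fun a ha x hx =>
  ha x (by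
    change (x : Qbarˣ) ^ n ∈ base r
    rw [← Subgroup.coe_pow, show x ^ n = 1 from hx]
    exact (base r).one_mem)

theorem inv_mul_mem_fixer {a b : A r} {s : Set (radInf r)} :
    a⁻¹ * b ∈ fixer r s ↔ ∀ x ∈ s, b.1 x = a.1 x :=
  forall₂_congr fun x _ => by rw [mul_apply, inv_apply_eq]

/-- Elements of `A` fix the radicals that are rational. -/
theorem apply_rat (a : A r) (x : radInf r) (q : ℚ)
    (hx : ((x : Qbarˣ) : Qbar) = algebraMap ℚ Qbar q) :
    a.1 x = x := by
  have hq : q ≠ 0 := by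
    rintro rfl
    exact (x : Qbarˣ).ne_zero (by rw [hx, map_zero])
  exact a.2 x ⟨Units.mk0 q hq, Units.ext hx.symm⟩

theorem mem_radInf_of_pow_eq_one {u : Qbarˣ} {M : ℕ} (hM : 0 < M) (hu : u ^ M = 1) :
    u ∈ radInf r := ⟨M, hM, by
  change u ^ M ∈ base r
  rw [hu]
  exact (base r).one_mem⟩

/-- `a x / x` is an `n`-th root of unity if `x ∈ R_n`. -/
theorem apply_div_pow (a : A r) (x : radInf r) {n : ℕ} (hx : (x : Qbarˣ) ∈ rad r n) :
    (a.1 x / x) ^ n = 1 := by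
  have : a.1 (x ^ n) = x ^ n := a.2 (x ^ n) (base_le_range r hx)
  rw [div_pow, ← map_pow, this, div_self']

theorem exists_primitiveRoot_radInf (r : ℚˣ) {M : ℕ} (hM : 0 < M) :
    ∃ z : radInf r, IsPrimitiveRoot z M := by
  have : NeZero M := ⟨hM.ne'⟩
  obtain ⟨ζ, hζ⟩ := HasEnoughRootsOfUnity.exists_primitiveRoot Qbar M
  obtain ⟨u, rfl⟩ := hζ.isUnit hM.ne'
  have hu : IsPrimitiveRoot u M := IsPrimitiveRoot.coe_units_iff.1 hζ
  exact ⟨⟨u, mem_radInf_of_pow_eq_one hM hu.pow_eq_one⟩, IsPrimitiveRoot.coe_submonoidClass_iff.1 hu⟩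

/-- The roots of unity of order dividing `M` are the powers of a primitive one. -/
theorem exists_pow_of_pow_eq_one {M : ℕ} (hM : 0 < M) {z u : radInf r} (hz : IsPrimitiveRoot z M)
    (hu : u ^ M = 1) : ∃ i : ℕ, u = z ^ i := by
  have hz' : IsPrimitiveRoot ((z : Qbarˣ) : Qbar) M :=
    IsPrimitiveRoot.coe_units_iff.2 (IsPrimitiveRoot.coe_submonoidClass_iff.2 hz)
  have : NeZero M := ⟨hM.ne'⟩
  obtain ⟨i, -, hi⟩ := hz'.eq_pow_of_pow_eq_one (ξ := ((u : Qbarˣ) : Qbar)) (by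
    have := congrArg (fun t : radInf r => ((t : Qbarˣ) : Qbar)) hu
    simpa using this)
  exact ⟨i, radInf_ext (by simpa using hi.symm)⟩

/-- Irreducibility of the cyclotomic polynomials. -/
theorem exists_absRep_primitiveRoot {M : ℕ} (hM : 0 < M) {z w : radInf r} (hz : IsPrimitiveRoot z M)
    (hw : IsPrimitiveRoot w M) : ∃ σ, (absRep r σ).1 z = w := by
  have h : ∀ {z : radInf r}, IsPrimitiveRoot z M → IsPrimitiveRoot ((z : Qbarˣ) : Qbar) M :=
    fun hz => IsPrimitiveRoot.coe_units_iff.2 (IsPrimitiveRoot.coe_submonoidClass_iff.2 hz)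
  have hc : IsConjRoot ℚ ((w : Qbarˣ) : Qbar) ((z : Qbarˣ) : Qbar) := by
    have h1 := Polynomial.cyclotomic_eq_minpoly_rat (h hw) hM
    have h2 := Polynomial.cyclotomic_eq_minpoly_rat (h hz) hM
    rw [IsConjRoot, ← h1, ← h2]
  obtain ⟨σ, hσ⟩ := isConjRoot_iff_exists_algEquiv.1 hc
  exact ⟨σ, radInf_ext (by rw [coe_absRep, hσ])⟩

/-- Every element of `A` acts on the `M`-th roots of unity as an element of the Galois group. -/
theorem exists_absRep_inv_mul_mem_rootFixer (a : A r) {M : ℕ} (hM : 0 < M) :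
    ∃ σ, (absRep r σ)⁻¹ * a ∈ rootFixer r M := by
  obtain ⟨z, hz⟩ := exists_primitiveRoot_radInf r hM
  obtain ⟨σ, hσ⟩ := exists_absRep_primitiveRoot hM hz (hz.map_of_injective a.1.injective)
  refine ⟨σ, inv_mul_mem_fixer.2 fun u hu => ?_⟩
  obtain ⟨i, rfl⟩ := exists_pow_of_pow_eq_one hM hz hu
  rw [map_pow, map_pow, hσ]

/-- There is an element of the Galois group that inverts the `M`-th roots of unity, as complex
conjugation does. -/
theorem exists_absRep_inv {M : ℕ} (hM : 0 < M) :
    ∃ σ, ∀ u : radInf r, u ^ M = 1 → (absRep r σ).1 u = u⁻¹ := by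
  obtain ⟨z, hz⟩ := exists_primitiveRoot_radInf r hM
  obtain ⟨σ, hσ⟩ := exists_absRep_primitiveRoot hM hz hz.inv
  refine ⟨σ, fun u hu => ?_⟩
  obtain ⟨i, rfl⟩ := exists_pow_of_pow_eq_one hM hz hu
  rw [map_pow, hσ, inv_pow]

/-- The elements of `A` commute on roots of unity. -/
theorem commutator_mem_rootFixer (a b : A r) {M : ℕ} (hM : 0 < M) :
    a⁻¹ * b⁻¹ * a * b ∈ rootFixer r M := by
  obtain ⟨z, hz⟩ := exists_primitiveRoot_radInf r hM
  obtain ⟨i, hi⟩ := exists_pow_of_pow_eq_one hM hz (hz.map_of_injective a.1.injective).pow_eq_one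
  obtain ⟨j, hj⟩ := exists_pow_of_pow_eq_one hM hz (hz.map_of_injective b.1.injective).pow_eq_one
  have h : a⁻¹ * b⁻¹ * a * b = (b * a)⁻¹ * (a * b) := by group
  rw [h, inv_mul_mem_fixer]
  intro u hu
  obtain ⟨k, rfl⟩ := exists_pow_of_pow_eq_one hM hz hu
  rw [mul_apply, mul_apply, map_pow, map_pow, map_pow, map_pow, hi, hj, map_pow, map_pow, hi, hj]
  simp only [← pow_mul]
  congr 1
  ring

/-! ### Perfect powers of rational numbers -/

/-- The exponents `k` such that a rational number `q ≠ 0, 1, -1` is a `k`-th power are bounded. -/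
theorem exponent_le {q : ℚ} (h0 : q ≠ 0) (h1 : q ≠ 1) (h2 : q ≠ -1) {k : ℕ} {s : ℚ}
    (hs : s ^ k = q) : k ≤ q.num.natAbs + q.den := by
  have hn : s.num.natAbs ^ k = q.num.natAbs := by rw [← hs, Rat.num_pow, Int.natAbs_pow]
  have hd : s.den ^ k = q.den := by rw [← hs, Rat.den_pow]
  have key : ∀ m : ℕ, m ^ k ≠ 0 → m ^ k ≠ 1 → k ≤ m ^ k := by
    intro m hm0 hm1
    rcases Nat.eq_zero_or_pos k with rfl | hk
    · exact Nat.zero_le _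
    have hm : 2 ≤ m := by
      rcases m with _ | _ | m
      · exact absurd (zero_pow hk.ne') hm0
      · exact absurd (one_pow k) hm1
      · omega
    exact (Nat.lt_pow_self hm).le
  have hn0 : q.num.natAbs ≠ 0 := by simpa using h0
  have hd0 := q.den_ne_zero
  by_cases hn1 : q.num.natAbs = 1
  · have hd1 : q.den ≠ 1 := by
      intro hd1
      have hq : ((q.num : ℤ) : ℚ) = q := Rat.coe_int_num_of_den_eq_one hd1
      rcases Int.natAbs_eq q.num with h | h <;> rw [hn1] at h
      · exact h1 (by rw [← hq, h]; norm_num)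
      · exact h2 (by rw [← hq, h]; norm_num)
    have := key s.den (by rwa [hd]) (by rwa [hd])
    omega
  · have := key s.num.natAbs (by rwa [hn]) (by rwa [hn])
    omega

/-- A positive rational number `q ≠ 1` is a power of some `ρ > 0` that generates the group of all
positive rational numbers having a power in `⟨q⟩`. -/
theorem exists_primitive_root_rat {q : ℚ} (h0 : 0 < q) (h1 : q ≠ 1) :
    ∃ ρ : ℚ, 0 < ρ ∧ ∃ h : ℕ, 0 < h ∧ q = ρ ^ h ∧
      ∀ t : ℚ, 0 < t → ∀ n : ℕ, 0 < n → ∀ i : ℤ, t ^ n = q ^ i → ∃ m : ℤ, t = ρ ^ m := by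
  classical
  let P : ℕ → Prop := fun h => ∃ ρ : ℚ, 0 < ρ ∧ q = ρ ^ h
  have hb : ∀ h, P h → h ≤ q.num.natAbs + q.den := by
    rintro h ⟨ρ, -, hρ⟩
    exact exponent_le h0.ne' h1 (by linarith) hρ.symm
  have hP1 : P 1 := ⟨q, h0, (pow_one q).symm⟩
  set h := Nat.findGreatest P (q.num.natAbs + q.den) with hh
  have hPh : P h := Nat.findGreatest_spec (hb 1 hP1) hP1
  have hmax : ∀ k, P k → k ≤ h := fun k hk => Nat.le_findGreatest (hb k hk) hk
  have hpos : 0 < h := hmax 1 hP1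
  obtain ⟨ρ, hρ0, hρ⟩ := hPh
  refine ⟨ρ, hρ0, h, hpos, hρ, fun t ht n hn i hti => ?_⟩
  have hti' : t ^ (n : ℤ) = ρ ^ ((h : ℤ) * i) := by
    rw [zpow_natCast, hti, hρ, zpow_mul, zpow_natCast]
  -- after division by the greatest common divisor the two exponents `n'` and `m` are coprime
  obtain ⟨g, n', m, hg, hcop, hn', hm⟩ := Int.exists_gcd_one' (m := (n : ℤ)) (n := (h : ℤ) * i)
    (Int.gcd_pos_of_ne_zero_left _ (by exact_mod_cast hn.ne'))
  have hn'pos : 0 < n' := by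
    have : (0 : ℤ) < n' * g := by rw [← hn']; exact_mod_cast hn
    exact pos_of_mul_pos_left this (by positivity)
  have heq : t ^ n' = ρ ^ m := by
    rw [hn', hm, zpow_mul, zpow_mul, zpow_natCast, zpow_natCast] at hti'
    exact (pow_left_inj₀ (by positivity) (by positivity) hg.ne').1 hti'
  obtain ⟨u, v, huv⟩ := Int.isCoprime_iff_gcd_eq_one.2 hcop
  have hx : (ρ ^ u * t ^ v) ^ n' = ρ := by
    rw [mul_zpow, ← zpow_mul, ← zpow_mul, mul_comm v, zpow_mul t, heq, ← zpow_mul,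
      ← zpow_add₀ hρ0.ne', mul_comm m, huv, zpow_one]
  lift n' to ℕ using hn'pos.le
  have hPn : P (n' * h) := by
    refine ⟨ρ ^ u * t ^ v, by positivity, ?_⟩
    rw [pow_mul, ← zpow_natCast _ n', hx, hρ]
  have : n' = 1 := by
    have h1 := hmax _ hPn
    have h2 : 0 < n' := by exact_mod_cast hn'pos
    nlinarith
  subst this
  exact ⟨m, by simpa using heq⟩

/-! ### The Kummer theory of `R_∞` over `ℚ(μ_∞)` -/

/-- `β` is a square root of a positive rational number `ρ` such that `|r| = ρ ^ h` and such that
the rational numbers in `R_∞` are up to sign the powers of `ρ`. -/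
structure IsSqrtGenerator (r : ℚˣ) (ρ : ℚ) (h : ℕ) (β : radInf r) : Prop where
  pos : 0 < ρ
  exponent_pos : 0 < h
  abs_eq : |(r : ℚ)| = ρ ^ h
  exists_zpow : ∀ t : ℚ, ∀ n : ℕ, 0 < n → ∀ i : ℤ, t ^ n = (r : ℚ) ^ i → ∃ m : ℤ, |t| = ρ ^ m
  sq_eq : ((β : Qbarˣ) : Qbar) ^ 2 = algebraMap ℚ Qbar ρ

theorem exists_isSqrtGenerator (h1 : (r : ℚ) ≠ 1) (h2 : (r : ℚ) ≠ -1) :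
    ∃ ρ h β, IsSqrtGenerator r ρ h β := by
  have habs : |(r : ℚ)| ≠ 1 := by
    intro h
    rcases (abs_eq zero_le_one).1 h with h | h
    · exact h1 h
    · exact h2 h
  obtain ⟨ρ, hρ, h, hh, hr, hgen⟩ := exists_primitive_root_rat (abs_pos.2 r.ne_zero) habs
  obtain ⟨b, hb⟩ := IsAlgClosed.exists_pow_nat_eq (algebraMap ℚ Qbar ρ) two_pos
  have hb0 : b ≠ 0 := by
    rintro rfl
    rw [zero_pow two_ne_zero] at hb
    exact hρ.ne' ((algebraMap ℚ Qbar).injective (by rw [← hb, map_zero]))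
  refine ⟨ρ, h, ⟨Units.mk0 b hb0, 4 * h, by positivity, ?_⟩, hρ, hh, hr, ?_, hb⟩
  · refine ⟨2, Units.ext ?_⟩
    have h3 : (r : ℚ) ^ 2 = ρ ^ (2 * h) := by rw [← sq_abs, hr, ← pow_mul, mul_comm]
    change (ratUnits r ^ (2 : ℤ) : Qbarˣ).val = (Units.mk0 b hb0 ^ (4 * h) : Qbarˣ).val
    rw [zpow_ofNat, Units.val_pow_eq_pow_val, Units.val_pow_eq_pow_val]
    change (algebraMap ℚ Qbar r) ^ 2 = b ^ (4 * h)
    rw [← map_pow, h3, map_pow, ← hb, ← pow_mul]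
    congr 1
    ring
  · intro t n hn i hti
    have hr0 : (r : ℚ) ≠ 0 := r.ne_zero
    have ht : t ≠ 0 := by
      rintro rfl
      rw [zero_pow hn.ne'] at hti
      exact zpow_ne_zero i hr0 hti.symm
    exact hgen |t| (abs_pos.2 ht) n hn i (by rw [← abs_pow, hti, abs_zpow])

theorem IsSqrtGenerator.apply_sq {ρ : ℚ} {h : ℕ} {β : radInf r}
    (hβ : IsSqrtGenerator r ρ h β) (a : A r) : a.1 β ^ 2 = β ^ 2 := by
  rw [← map_pow]
  exact apply_rat a _ ρ (by simpa using hβ.sq_eq)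

theorem coe_eq_neg_one {u : radInf r} (hu : u ^ 2 = 1) (hne : u ≠ 1) :
    ((u : Qbarˣ) : Qbar) = -1 := by
  have h : ((u : Qbarˣ) : Qbar) ^ 2 = 1 := by
    have := congrArg (fun t : radInf r => ((t : Qbarˣ) : Qbar)) hu
    simpa using this
  rcases sq_eq_sq_iff_eq_or_eq_neg.1 (h.trans (one_pow 2).symm) with h | h
  · exact absurd (radInf_ext (by simpa using h)) hne
  · exact h

/-- An element of `R_∞` that lies in the abelian field `ℚ(μ_n)` is up to a root of unity a power
of `β`: it has a multiple `z` by a root of unity that is fixed by an element of the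
Galois group inverting roots of unity, so its conjugates can only be `z` and `-z`, and
`z ^ 2` is rational. -/
theorem apply_eq_of_abelian {ρ : ℚ} {h : ℕ} {β : radInf r}
    (hβ : IsSqrtGenerator r ρ h β) {n : ℕ} (hn : 0 < n) {x : radInf r}
    (hx : (x : Qbarˣ) ∈ rad r n)
    (hfix : ∀ σ, absRep r σ ∈ rootFixer r n → (absRep r σ).1 x = x)
    {b : A r} (hb : b ∈ rootFixer r (4 * n)) (hbβ : b.1 β = β) : b.1 x = x := by
  obtain ⟨c, hc⟩ := exists_absRep_inv (r := r) (M := 4 * n) (by positivity)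
  set η : radInf r := (absRep r c).1 x / x with hη
  have hηn : η ^ n = 1 := apply_div_pow _ x hx
  obtain ⟨ξ, hξ⟩ : ∃ ξ : radInf r, ξ ^ 2 = η := by
    obtain ⟨t, ht⟩ := IsAlgClosed.exists_pow_nat_eq ((η : Qbarˣ) : Qbar) two_pos
    have ht0 : t ≠ 0 := by
      rintro rfl
      rw [zero_pow two_ne_zero] at ht
      exact (η : Qbarˣ).ne_zero ht.symm
    have htu : (Units.mk0 t ht0) ^ 2 = (η : Qbarˣ) := Units.ext (by simpa using ht)
    refine ⟨⟨Units.mk0 t ht0, mem_radInf_of_pow_eq_one (M := 2 * n) (by positivity) ?_⟩,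
      Subtype.ext htu⟩
    rw [pow_mul, htu, ← Subgroup.coe_pow, hηn]
    rfl
  have hξn : ξ ^ (2 * n) = 1 := by rw [pow_mul, hξ, hηn]
  have h4 : ∀ u : radInf r, u ^ (2 * n) = 1 → u ^ (4 * n) = 1 := by
    intro u hu
    rw [show 4 * n = 2 * n * 2 by ring, pow_mul, hu, one_pow]
  set z : radInf r := ξ * x with hz
  have hxη : (absRep r c).1 x = η * x := by rw [hη, div_mul_cancel]
  have hcz : (absRep r c).1 z = z := by
    rw [hz, map_mul, hc ξ (h4 _ hξn), hxη, ← hξ, sq, ← mul_assoc, inv_mul_cancel_left]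
  have hzrad : (z : Qbarˣ) ∈ rad r (2 * n) := by
    refine (rad r (2 * n)).mul_mem ?_ (rad_mono (dvd_mul_left n 2) hx)
    change (ξ : Qbarˣ) ^ (2 * n) ∈ base r
    rw [← Subgroup.coe_pow, hξn]
    exact (base r).one_mem
  -- the conjugates of `z` are `z` and `-z`
  have hconj : ∀ σ, (absRep r σ).1 z ^ 2 = z ^ 2 := by
    intro σ
    set θ : radInf r := (absRep r σ).1 z / z with hθ
    have hθn : θ ^ (2 * n) = 1 := apply_div_pow _ z hzrad
    have hσz : (absRep r σ).1 z = θ * z := by rw [hθ, div_mul_cancel]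
    set τ := (absRep r σ)⁻¹ * (absRep r c)⁻¹ * absRep r σ * absRep r c with hτ
    have hτM : τ ∈ rootFixer r (4 * n) := commutator_mem_rootFixer _ _ (by positivity)
    have hτz : τ.1 z = z := by
      have hτG : τ = absRep r (σ⁻¹ * c⁻¹ * σ * c) := by simp [hτ]
      have h1 : τ.1 x = x := by
        rw [hτG]
        refine hfix _ ?_
        rw [← hτG]
        exact rootFixer_anti (dvd_mul_left n 4) hτM
      rw [hz, map_mul, h1, hτM ξ (h4 _ hξn)]
    have hcomm : absRep r σ * absRep r c = absRep r c * absRep r σ * τ := by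
      rw [hτ]; group
    have h1 : (absRep r c).1 ((absRep r σ).1 z) = (absRep r σ).1 z := by
      have := congrArg (fun a : A r => a.1 z) hcomm
      simp only [mul_apply, hτz, hcz] at this
      exact this.symm
    rw [hσz, map_mul, hcz, hc θ (h4 _ hθn), mul_left_inj] at h1
    have h2 : θ ^ 2 = 1 := by rw [sq, ← inv_mul_cancel θ, h1]
    rw [hσz, mul_pow, h2, one_mul]
  obtain ⟨q, hq⟩ : ∃ q : ℚ, algebraMap ℚ Qbar q = ((z : Qbarˣ) : Qbar) ^ 2 := by
    refine IntermediateField.mem_bot.1 ((InfiniteGalois.mem_bot_iff_fixed _).2 fun σ => ?_)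
    have := congrArg (fun t : radInf r => ((t : Qbarˣ) : Qbar)) (hconj σ)
    simpa [coe_absRep] using this
  obtain ⟨i, hi⟩ := hzrad
  have hqn : q ^ n = (r : ℚ) ^ i := by
    refine (algebraMap ℚ Qbar).injective ?_
    have := congrArg (fun t : Qbarˣ => (t : Qbar)) hi
    simp only [Units.val_pow_eq_pow_val, Units.val_zpow_eq_zpow_val] at this
    rw [map_pow, hq, ← pow_mul, ← this, map_zpow₀]
    rfl
  obtain ⟨m, hm⟩ := hβ.exists_zpow q n hn i hqn
  -- `z / β ^ m` is a fourth root of unity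
  have hzβ : (z / β ^ m) ^ 4 = 1 := by
    rw [div_pow, div_eq_one]
    refine radInf_ext ?_
    have h1 : ((z : Qbarˣ) : Qbar) ^ 4 = ((β : Qbarˣ) : Qbar) ^ (2 * (2 * m)) := by
      rw [show (4 : ℕ) = 2 * 2 from rfl, pow_mul, ← hq, ← map_pow, ← sq_abs, hm, zpow_mul,
        zpow_ofNat, hβ.sq_eq, ← map_zpow₀, ← zpow_natCast, ← zpow_mul]
      congr 2
      push_cast
      ring
    simp only [Subgroup.coe_pow, Subgroup.coe_zpow, Units.val_pow_eq_pow_val,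
      Units.val_zpow_eq_zpow_val, h1]
    rw [← zpow_natCast, ← zpow_mul]
    congr 1
    push_cast
    ring
  have hx' : x = ξ⁻¹ * (z / β ^ m) * β ^ m := by
    rw [mul_assoc, div_mul_cancel, hz, inv_mul_cancel_left]
  have hb1 : b.1 (z / β ^ m) = z / β ^ m := hb _ (by
    change _ ^ (4 * n) = 1
    rw [pow_mul, hzβ, one_pow])
  rw [hx', map_mul, map_mul, map_inv, map_zpow, hbβ, hb1, hb ξ (h4 _ hξn)]

theorem exists_root (r : ℚˣ) {n : ℕ} (hn : 0 < n) :
    ∃ α : radInf r, ((α : Qbarˣ)) ^ n = ratUnits r := by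
  obtain ⟨t, ht⟩ := IsAlgClosed.exists_pow_nat_eq ((ratUnits r : Qbarˣ) : Qbar) hn
  have ht0 : t ≠ 0 := by
    rintro rfl
    rw [zero_pow hn.ne'] at ht
    exact (ratUnits r).ne_zero ht.symm
  have htu : (Units.mk0 t ht0) ^ n = ratUnits r := Units.ext (by simpa using ht)
  refine ⟨⟨Units.mk0 t ht0, n, hn, ?_⟩, htu⟩
  change _ ^ n ∈ base r
  rw [htu]
  exact Subgroup.mem_zpowers _

/-- `R_n` is generated by the `n`-th roots of unity and one `n`-th root `α` of `r`. -/
theorem exists_eq_mul_zpow {n : ℕ} {α x : radInf r} (hα : (α : Qbarˣ) ^ n = ratUnits r)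
    (hx : (x : Qbarˣ) ∈ rad r n) : ∃ u : radInf r, u ^ n = 1 ∧ ∃ i : ℤ, x = u * α ^ i := by
  obtain ⟨i, hi⟩ := hx
  refine ⟨x / α ^ i, ?_, i, (div_mul_cancel _ _).symm⟩
  rw [div_pow, div_eq_one]
  refine Subtype.ext ?_
  change ratUnits r ^ i = (x : Qbarˣ) ^ n at hi
  rw [Subgroup.coe_pow, Subgroup.coe_pow, Subgroup.coe_zpow, ← hi, ← hα, ← zpow_natCast,
    ← zpow_natCast, zpow_comm]

theorem mem_rad_of_pow_eq {n : ℕ} {α : Qbarˣ} (hα : α ^ n = ratUnits r) : α ∈ rad r n := by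
  change α ^ n ∈ base r
  rw [hα]
  exact Subgroup.mem_zpowers _

/-- Elements of `A` that agree on the `n`-th roots of unity and on an `n`-th root of `r`
agree on `R_n`. -/
theorem mem_radFixer {n : ℕ} {α : radInf r} (hα : (α : Qbarˣ) ^ n = ratUnits r) {a : A r}
    (h1 : a ∈ rootFixer r n) (h2 : a.1 α = α) : a ∈ radFixer r n := by
  intro x hx
  obtain ⟨u, hu, i, rfl⟩ := exists_eq_mul_zpow hα hx
  rw [map_mul, map_zpow, h2, h1 u hu]

/-- Kummer theory: an element of `A` that fixes `β` and sufficiently many roots of unity agrees on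
`R_n` with an element of the Galois group. With `α ^ n = r` and `C` the group of the
roots of unity `σ(α) / α`, for `σ` fixing `μ_n`, the power `α ^ #C` lies in `ℚ(μ_n)`,
and all `#C`-th roots of unity lie in `C`. -/
theorem exists_absRep_inv_mul_mem_radFixer {ρ : ℚ} {h : ℕ} {β : radInf r}
    (hβ : IsSqrtGenerator r ρ h β) {n : ℕ} (hn : 0 < n)
    {b : A r} (hb : b ∈ rootFixer r (4 * n)) (hbβ : b.1 β = β) :
    ∃ σ, (absRep r σ)⁻¹ * b ∈ radFixer r n := by
  obtain ⟨α, hα⟩ := exists_root r hn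
  have hαn : (α : Qbarˣ) ∈ rad r n := mem_rad_of_pow_eq hα
  have hbn : b ∈ rootFixer r n := rootFixer_anti (dvd_mul_left n 4) hb
  let C : Subgroup (radInf r) :=
    { carrier := {u | u ^ n = 1 ∧ ∃ σ, absRep r σ ∈ rootFixer r n ∧ (absRep r σ).1 α = u * α}
      mul_mem' := by
        rintro u v ⟨hu, σ, hσ, hσα⟩ ⟨hv, τ, hτ, hτα⟩
        refine ⟨by rw [mul_pow, hu, hv, one_mul], σ * τ, ?_, ?_⟩
        · rw [map_mul]
          exact mul_mem hσ hτ
        · rw [map_mul, mul_apply, hτα, map_mul, hσ v hv, hσα]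
          simp only [← mul_assoc, mul_comm v u]
      one_mem' := ⟨one_pow n, 1, by rw [map_one]; exact one_mem _, by rw [map_one, one_mul]; rfl⟩
      inv_mem' := by
        rintro u ⟨hu, σ, hσ, hσα⟩
        have hσ' : (absRep r σ)⁻¹ ∈ rootFixer r n := inv_mem hσ
        refine ⟨by rw [inv_pow, hu, inv_one], σ⁻¹, by rwa [map_inv], ?_⟩
        rw [map_inv, inv_apply_eq, map_mul, map_inv, hσ u hu, hσα, inv_mul_cancel_left] }
  let ι : radInf r →* Qbarˣ := (radInf r).subtype
  have hι : Function.Injective ι := (radInf r).subtype_injective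
  have hle : C.map ι ≤ rootsOfUnity n Qbar := by
    rintro _ ⟨u, ⟨hu, -⟩, rfl⟩
    change (u : Qbarˣ) ^ n = 1
    rw [← Subgroup.coe_pow, hu]
    rfl
  have : NeZero n := ⟨hn.ne'⟩
  have : Finite (C.map ι) := Finite.of_injective _ (Subgroup.inclusion_injective hle)
  set m := Nat.card (C.map ι) with hm
  have hm0 : 0 < m := Nat.card_pos
  have hCm : C.map ι = rootsOfUnity m Qbar := by
    have : NeZero m := ⟨hm0.ne'⟩
    refine Subgroup.eq_of_le_of_card_ge (fun u hu => ?_) ?_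
    · have := pow_card_eq_one' (x := (⟨u, hu⟩ : C.map ι))
      exact congrArg Subtype.val this
    · rw [← hm]
      exact card_rootsOfUnity Qbar m
  have hfix : b.1 (α ^ m) = α ^ m := by
    refine apply_eq_of_abelian hβ hn ((rad r n).pow_mem hαn m) (fun σ hσ => ?_) hb hbβ
    have hC : (absRep r σ).1 α / α ∈ C := ⟨apply_div_pow _ α hαn, σ, hσ, (div_mul_cancel _ _).symm⟩
    have h1 : ι ((absRep r σ).1 α / α) ∈ rootsOfUnity m Qbar := hCm ▸ ⟨_, hC, rfl⟩
    have h2 : ((absRep r σ).1 α / α) ^ m = 1 := hι (by rw [map_pow, map_one]; exact h1)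
    rw [map_pow]
    rwa [div_pow, div_eq_one] at h2
  have hbC : ι (b.1 α / α) ∈ C.map ι := by
    rw [hCm]
    change ι (b.1 α / α) ^ m = 1
    rw [← map_pow, div_pow, ← map_pow b.1, hfix, div_self', map_one]
  obtain ⟨u, ⟨-, σ, hσ, hσα⟩, hu⟩ := hbC
  have huα : b.1 α = (absRep r σ).1 α := by rw [hσα, hι hu, div_mul_cancel]
  refine ⟨σ, mem_radFixer hα (mul_mem (inv_mem hσ) hbn) ?_⟩
  rw [mul_apply, inv_apply_eq, huα]

/-! ### The Galois group is a closed subgroup of index at most two -/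

theorem continuous_absRep (r : ℚˣ) : Continuous (absRep r) := by
  refine continuous_to_radAut _ fun x y => isOpen_iff_mem_nhds.2 fun σ hσ => ?_
  have hσ' : (absRep r σ).1 x = y := hσ
  let E : IntermediateField ℚ Qbar := IntermediateField.adjoin ℚ {((x : Qbarˣ) : Qbar)}
  have : FiniteDimensional ℚ E :=
    IntermediateField.adjoin.finiteDimensional (Algebra.IsIntegral.isIntegral _)
  have hopen : IsOpen (E.fixingSubgroup : Set Gal(Qbar/ℚ)) := E.fixingSubgroup_isOpen
  refine Filter.mem_of_superset ((hopen.leftCoset σ).mem_nhds ⟨1, one_mem _, mul_one σ⟩) ?_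
  rintro _ ⟨τ, hτ, rfl⟩
  change (absRep r (σ * τ)).1 x = y
  have hx : (absRep r τ).1 x = x := radInf_ext (by
    rw [coe_absRep]
    exact (IntermediateField.mem_fixingSubgroup_iff _ _).1 hτ _
      (IntermediateField.mem_adjoin_simple_self ℚ _))
  rw [map_mul, mul_apply, hx, hσ']

theorem isClosed_G (r : ℚˣ) : IsClosed (G r : Set (A r)) := by
  have : T2Space (A r) := by
    let _ : TopologicalSpace (radInf r) := ⊥
    have _ : DiscreteTopology (radInf r) := ⟨rfl⟩
    refine T2Space.of_injective_continuous (f := fun (a : A r) (x : radInf r) => a.1 x) ?_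
      continuous_induced_dom
    intro a b hab
    exact Subtype.ext (MulEquiv.ext fun x => congrFun hab x)
  rw [← range_absRep, MonoidHom.coe_range]
  exact (isCompact_range (continuous_absRep r)).isClosed

/-- `G` consists of the elements of `A` that agree on each `R_n` with an element of the
Galois group. -/
theorem mem_G_of_forall_radFixer {a : A r}
    (ha : ∀ n, 0 < n → ∃ σ, (absRep r σ)⁻¹ * a ∈ radFixer r n) : a ∈ G r := by
  let t : ℕ → Set (A r) := fun n => (G r : Set (A r)) ∩ {g | g⁻¹ * a ∈ radFixer r n.factorial}
  have hclosed : ∀ n, IsClosed (t n) := fun n => (isClosed_G r).inter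
    ((isClosed_fixer _).preimage (continuous_inv.mul continuous_const))
  have hne : (⋂ n, t n).Nonempty := by
    refine IsCompact.nonempty_iInter_of_sequence_nonempty_isCompact_isClosed t (fun n => ?_)
      (fun n => ?_) (hclosed 0).isCompact hclosed
    · rintro g ⟨hg, hga⟩
      exact ⟨hg, radFixer_anti (Nat.factorial_dvd_factorial n.le_succ) hga⟩
    · obtain ⟨σ, hσ⟩ := ha _ n.factorial_pos
      exact ⟨absRep r σ, absRep_mem_G σ, hσ⟩
  obtain ⟨g, hg⟩ := hne
  have hgG : g ∈ G r := (Set.mem_iInter.1 hg 0).1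
  have hag : a = g := by
    refine Subtype.ext (MulEquiv.ext fun x => ?_)
    obtain ⟨k, hk0, hk⟩ := x.2
    exact inv_mul_mem_fixer.1 (Set.mem_iInter.1 hg k).2 x
      (rad_mono (Nat.dvd_factorial hk0 le_rfl) hk)
  rwa [hag]

/-- If `x ^ 2` is rational then `x` and `-x` are its only possible images. -/
theorem apply_eq_of_ne {a b : A r} {x : radInf r} (hx : ∀ a : A r, a.1 x ^ 2 = x ^ 2)
    (ha : a.1 x ≠ x) (hb : b.1 x ≠ x) : a.1 x = b.1 x := by
  have key : ∀ {a : A r}, a.1 x ≠ x → ((a.1 x / x : radInf r) : Qbarˣ).val = -1 := by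
    intro a ha
    refine coe_eq_neg_one ?_ fun h => ha (div_eq_one.1 h)
    rw [div_pow, hx, div_self']
  exact div_left_injective (radInf_ext ((key ha).trans (key hb).symm))

theorem G_index (h1 : (r : ℚ) ≠ 1) (h2 : (r : ℚ) ≠ -1) : (G r).index = 1 ∨ (G r).index = 2 := by
  obtain ⟨ρ, h, β, hβ⟩ := exists_isSqrtGenerator h1 h2
  -- the quotient of two elements outside `G` is in `G`
  have key : ∀ a a' : A r, a ∉ G r → a' ∉ G r → a' * a⁻¹ ∈ G r := by
    intro a a' ha ha'
    have hex : ∀ {a : A r}, a ∉ G r → ∃ n, 0 < n ∧ ∀ σ, (absRep r σ)⁻¹ * a ∉ radFixer r n := by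
      intro a ha
      by_contra! hcon
      exact ha (mem_G_of_forall_radFixer hcon)
    obtain ⟨n, hn, hna⟩ := hex ha
    obtain ⟨n', hn', hna'⟩ := hex ha'
    refine mem_G_of_forall_radFixer fun k hk => ?_
    have hN : 0 < n * n' * k := by positivity
    obtain ⟨σ, hσ⟩ := exists_absRep_inv_mul_mem_rootFixer a (M := 4 * (n * n' * k)) (by positivity)
    obtain ⟨σ', hσ'⟩ :=
      exists_absRep_inv_mul_mem_rootFixer a' (M := 4 * (n * n' * k)) (by positivity)
    have hmove : ∀ {a : A r} {σ : Gal(Qbar/ℚ)} {m : ℕ}, m ∣ n * n' * k →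
        (∀ σ, (absRep r σ)⁻¹ * a ∉ radFixer r m) →
        (absRep r σ)⁻¹ * a ∈ rootFixer r (4 * (n * n' * k)) → ((absRep r σ)⁻¹ * a).1 β ≠ β := by
      intro a σ m hm ha hσ hfix
      obtain ⟨τ, hτ⟩ := exists_absRep_inv_mul_mem_radFixer hβ hN hσ hfix
      refine ha (σ * τ) (radFixer_anti hm ?_)
      rwa [map_mul, mul_inv_rev, mul_assoc (absRep r τ)⁻¹]
    have hb := hmove ⟨n' * k, by ring⟩ hna hσ
    have hb' := hmove ⟨n * k, by ring⟩ hna' hσ'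
    set b := (absRep r σ)⁻¹ * a with hbdef
    set b' := (absRep r σ')⁻¹ * a' with hbdef'
    have hinv : ∀ {b : A r}, b.1 β ≠ β → (b⁻¹).1 β ≠ β := fun hb h =>
      hb ((inv_apply_eq _ _ _).1 h).symm
    have hbb : (b' * b⁻¹).1 β = β := by
      rw [mul_apply, apply_eq_of_ne hβ.apply_sq (hinv hb) (hinv hb'), ← mul_apply, mul_inv_cancel]
      rfl
    obtain ⟨τ, hτ⟩ := exists_absRep_inv_mul_mem_radFixer hβ hN
      (mul_mem hσ' (inv_mem hσ)) hbb
    refine ⟨σ' * τ * σ⁻¹, radFixer_anti (dvd_mul_left k (n * n')) ?_⟩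
    have hconj := Subgroup.Normal.conj_mem inferInstance _ hτ (absRep r σ)
    convert hconj using 1
    rw [hbdef, hbdef', map_mul, map_mul, map_inv]
    group
  by_cases hG : ∀ a, a ∈ G r
  · left
    rw [Subgroup.index_eq_one]
    exact (Subgroup.eq_top_iff' _).2 hG
  · right
    push Not at hG
    obtain ⟨a, ha⟩ := hG
    refine Subgroup.index_eq_two_iff.2 ⟨a, fun b => ?_⟩
    by_cases hb : b ∈ G r
    · exact Or.inr ⟨hb, fun h => ha (((G r).mul_mem_cancel_left hb).1 h)⟩
    · refine Or.inl ⟨?_, hb⟩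
      have := key a⁻¹ b (fun h => ha (inv_mem_iff.1 h)) hb
      rwa [inv_inv] at this

/-! ### The decomposition of `A` as a product -/

/-- `v` is the `p`-primary part of the root of unity `u`. -/
def IsPrimaryPart (p : ℕ) (u v : radInf r) : Prop :=
  (∃ j : ℕ, v ^ p ^ j = 1) ∧ ∃ m : ℕ, m.Coprime p ∧ (u / v) ^ m = 1

theorem IsPrimaryPart.exists {p : ℕ} (hp : p.Prime) {u : radInf r} {N : ℕ} (hN : 0 < N)
    (hu : u ^ N = 1) : ∃ v, IsPrimaryPart p u v := by
  obtain ⟨j, m, hm, rfl⟩ := Nat.exists_eq_pow_mul_and_not_dvd hN.ne' p hp.ne_one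
  have hcop : m.Coprime p := ((Nat.Prime.coprime_iff_not_dvd hp).2 hm).symm
  have hcop' : (m : ℤ).gcd (p ^ j : ℕ) = 1 := by
    exact_mod_cast Nat.Coprime.pow_right j hcop
  obtain ⟨s, t, hst⟩ := Int.isCoprime_iff_gcd_eq_one.2 hcop'
  refine ⟨u ^ (s * m), ⟨j, ?_⟩, m, hcop, ?_⟩
  · rw [← zpow_natCast, ← zpow_mul, mul_assoc, mul_comm, mul_comm (m : ℤ), ← Nat.cast_mul, zpow_mul,
      zpow_natCast, hu, one_zpow]
  · have h1 : u / u ^ (s * m) = u ^ (t * (p ^ j : ℕ)) := by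
      rw [div_eq_iff_eq_mul, ← zpow_add, add_comm, hst, zpow_one]
    rw [h1, ← zpow_natCast, ← zpow_mul, mul_assoc, mul_comm, ← Nat.cast_mul, zpow_mul,
      zpow_natCast, hu, one_zpow]

theorem IsPrimaryPart.mul {p : ℕ} {u u' v v' : radInf r} (h : IsPrimaryPart p u v)
    (h' : IsPrimaryPart p u' v') : IsPrimaryPart p (u * u') (v * v') := by
  obtain ⟨⟨j, hj⟩, m, hm, hum⟩ := h
  obtain ⟨⟨j', hj'⟩, m', hm', hum'⟩ := h'
  refine ⟨⟨j + j', ?_⟩, m * m', hm.mul_left hm', ?_⟩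
  · rw [mul_pow, pow_add, pow_mul, hj, one_pow, mul_comm (p ^ j), pow_mul, hj', one_pow, one_mul]
  · rw [mul_div_mul_comm, mul_pow, pow_mul, hum, one_pow, mul_comm m, pow_mul, hum', one_pow,
      one_mul]

theorem IsPrimaryPart.inv {p : ℕ} {u v : radInf r} (h : IsPrimaryPart p u v) :
    IsPrimaryPart p u⁻¹ v⁻¹ := by
  obtain ⟨⟨j, hj⟩, m, hm, hum⟩ := h
  refine ⟨⟨j, by rw [inv_pow, hj, inv_one]⟩, m, hm, ?_⟩
  rw [← inv_div', inv_pow, hum, inv_one]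

theorem IsPrimaryPart.map {p : ℕ} {u v : radInf r} (h : IsPrimaryPart p u v) (a : A r) :
    IsPrimaryPart p (a.1 u) (a.1 v) := by
  obtain ⟨⟨j, hj⟩, m, hm, hum⟩ := h
  refine ⟨⟨j, by rw [← map_pow, hj, map_one]⟩, m, hm, ?_⟩
  rw [← map_div, ← map_pow, hum, map_one]

theorem IsPrimaryPart.unique {p : ℕ} {u v v' : radInf r} (h : IsPrimaryPart p u v)
    (h' : IsPrimaryPart p u v') : v = v' := by
  obtain ⟨⟨j, hj⟩, m, hm, h1⟩ := h'.mul h.inv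
  rw [mul_inv_cancel, one_div, inv_pow, inv_eq_one] at h1
  have hcop : (p ^ j).Coprime m := (hm.pow_right j).symm
  have : v' * v⁻¹ = 1 := by
    rw [← orderOf_eq_one_iff, ← Nat.dvd_one, ← hcop]
    exact Nat.dvd_gcd (orderOf_dvd_of_pow_eq_one hj) (orderOf_dvd_of_pow_eq_one h1)
  exact (mul_inv_eq_one.1 this).symm

theorem IsPrimaryPart.self {p : ℕ} {u v : radInf r} (h : IsPrimaryPart p u v) :
    IsPrimaryPart p v v :=
  ⟨h.1, 1, Nat.coprime_one_left p, by rw [div_self', one_pow]⟩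

theorem isPrimaryPart_one (p : ℕ) : IsPrimaryPart p (1 : radInf r) 1 :=
  ⟨⟨0, one_pow _⟩, 1, Nat.coprime_one_left p, by simp⟩

/-- The `p`-component of `a ∈ A`, which acts as `a` on `R_{p^∞}` and trivially on `R_{q^∞}` for
the primes `q ≠ p`. It multiplies `x` by the `p`-primary part of the root of unity `a x / x`. -/
theorem exists_component (a : A r) {p : ℕ} (hp : p.Prime) :
    ∃ k : A r, (∀ (x : radInf r) (j : ℕ), (a.1 x / x) ^ p ^ j = 1 → k.1 x = a.1 x) ∧
      ∀ (x : radInf r) (m : ℕ), m.Coprime p → (a.1 x / x) ^ m = 1 → k.1 x = x := by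
  have hex : ∀ (a : A r) (x : radInf r), ∃ v, IsPrimaryPart p (a.1 x / x) v := by
    intro a x
    obtain ⟨k, hk0, hk⟩ := x.2
    exact IsPrimaryPart.exists hp hk0 (apply_div_pow a x hk)
  choose f hf using hex
  have hmul : ∀ a x y, f a (x * y) = f a x * f a y := by
    intro a x y
    refine (hf a (x * y)).unique ?_
    rw [map_mul, mul_div_mul_comm]
    exact (hf a x).mul (hf a y)
  have hinv : ∀ a x, f a⁻¹ (x * f a x) = (f a x)⁻¹ := by
    intro a x
    refine (hf a⁻¹ (x * f a x)).unique ?_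
    have h1 := (((hf a x).inv.map a⁻¹).mul (hf a x).self.inv).mul ((hf a x).self.map a⁻¹)
    have h2 : (a⁻¹).1 (a.1 x) = x := (inv_apply_eq a _ _).2 rfl
    convert h1 using 1
    · rw [inv_div, map_div, map_mul, h2, div_eq_mul_inv, div_eq_mul_inv, mul_inv]
      ac_rfl
    · rw [map_inv, mul_right_comm, inv_mul_cancel, one_mul]
  have hleft : ∀ a x, (x * f a x) * f a⁻¹ (x * f a x) = x := by
    intro a x
    rw [hinv, mul_inv_cancel_right]
  refine ⟨⟨{ toFun := fun x => x * f a x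
             invFun := fun x => x * f a⁻¹ x
             left_inv := hleft a
             right_inv := fun x => by simpa using hleft a⁻¹ x
             map_mul' := fun x y => by rw [hmul, mul_mul_mul_comm] }, fun x hx => ?_⟩, ?_, ?_⟩
  · change x * f a x = x
    have h1 := hf a x
    rw [show a.1 x = x from a.2 x hx, div_self'] at h1
    rw [h1.unique (isPrimaryPart_one p), mul_one]
  · intro x j hj
    change x * f a x = a.1 x
    rw [(hf a x).unique ⟨⟨j, hj⟩, 1, Nat.coprime_one_left p, by rw [div_self', one_pow]⟩,
      mul_div_cancel]
  · intro x m hm hx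
    change x * f a x = x
    rw [(hf a x).unique ⟨⟨0, one_pow _⟩, m, hm, by rwa [div_one]⟩, mul_one]

/-- The intersection of the stabilizers of `R_p` for the primes `p ∈ T`. -/
def finsetFixer (r : ℚˣ) (T : Finset Nat.Primes) : Subgroup (A r) := ⨅ p ∈ T, radFixer r p

theorem mem_finsetFixer {T : Finset Nat.Primes} {a : A r} :
    a ∈ finsetFixer r T ↔ ∀ p ∈ T, a ∈ radFixer r p := by
  simp only [finsetFixer, Subgroup.mem_iInf]

instance (T : Finset Nat.Primes) : (finsetFixer r T).Normal where
  conj_mem a ha g := mem_finsetFixer.2 fun p hp =>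
    Subgroup.Normal.conj_mem inferInstance a (mem_finsetFixer.1 ha p hp) g

theorem coe_finsetFixer (T : Finset Nat.Primes) :
    (finsetFixer r T : Set (A r)) = ⋂ p ∈ T, (radFixer r p : Set (A r)) := by
  ext a
  simp [mem_finsetFixer]

theorem exists_component_mem (a : A r) (p : Nat.Primes) :
    ∃ k : A r, (∀ q : Nat.Primes, q ≠ p → k ∈ radFixer r q) ∧ k⁻¹ * a ∈ radFixer r p := by
  obtain ⟨k, hk1, hk2⟩ := exists_component a p.2
  refine ⟨k, fun q hq x hx => hk2 x q ?_ (apply_div_pow a x hx), inv_mul_mem_fixer.2 fun x hx => ?_⟩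
  · exact (Nat.coprime_primes q.2 p.2).2 fun h => hq (Subtype.ext h)
  · exact (hk1 x 1 (by rw [pow_one]; exact apply_div_pow a x hx)).symm

theorem radFixer_sup_finsetFixer {p : Nat.Primes} {T : Finset Nat.Primes} (hp : p ∉ T) :
    radFixer r p ⊔ finsetFixer r T = ⊤ := by
  refine (Subgroup.eq_top_iff' _).2 fun a => ?_
  obtain ⟨k, hk1, hk2⟩ := exists_component_mem a p
  have hk : k ∈ finsetFixer r T := mem_finsetFixer.2 fun q hq => hk1 q (by rintro rfl; exact hp hq)
  rw [← mul_inv_cancel_left k a]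
  exact mul_mem (Subgroup.mem_sup_right hk) (Subgroup.mem_sup_left hk2)

theorem index_finsetFixer (T : Finset Nat.Primes) :
    (finsetFixer r T).index = ∏ p ∈ T, (radFixer r p).index := by
  classical
  induction T using Finset.induction_on with
  | empty => simp [finsetFixer]
  | insert p T hp ih =>
    rw [Finset.prod_insert hp, ← ih]
    have h1 : finsetFixer r (insert p T) = radFixer r p ⊓ finsetFixer r T := by
      ext a
      simp [mem_finsetFixer]
    have h2 : (radFixer r p).relIndex (finsetFixer r T) = (radFixer r p).index := by
      rw [← Subgroup.relIndex_sup_left, radFixer_sup_finsetFixer hp, Subgroup.relIndex_top_right]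
    rw [h1, ← h2, ← Subgroup.inf_relIndex_right, Subgroup.relIndex_mul_index inf_le_right]

/-! ### The discriminant of a quadratic field -/

section Quadratic

variable {K : Type*} [Field K] [NumberField K] {δ : K} {q : ℚ}

/-- The basis `1, √q` of a quadratic field. -/
theorem exists_basis_sqrt (hδ : δ ^ 2 = algebraMap ℚ K q) (hq : ¬ IsSquare q)
    (hK : Module.finrank ℚ K = 2) :
    ∃ b : Module.Basis (Fin 2) ℚ K, b 0 = 1 ∧ b 1 = δ := by
  have hli : LinearIndependent ℚ ![(1 : K), δ] := by
    rw [LinearIndependent.pair_iff]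
    intro s t hst
    have ht : t = 0 := by
      by_contra ht
      have h1 : δ = algebraMap ℚ K (-s / t) := by
        have ht' : algebraMap ℚ K t ≠ 0 := by simpa using ht
        rw [map_div₀, map_neg, eq_div_iff ht']
        rw [Algebra.smul_def, Algebra.smul_def, mul_one] at hst
        linear_combination hst
      refine hq ⟨-s / t, (algebraMap ℚ K).injective ?_⟩
      rw [← hδ, h1, map_mul, sq]
    subst ht
    exact ⟨by simpa using hst, rfl⟩
  refine ⟨basisOfLinearIndependentOfCardEqFinrank hli (by simp [hK]), ?_, ?_⟩ <;> simp

theorem leftMulMatrix_sqrt (hδ : δ ^ 2 = algebraMap ℚ K q) {b : Module.Basis (Fin 2) ℚ K}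
    (h0 : b 0 = 1) (h1 : b 1 = δ) (x y : ℚ) :
    Algebra.leftMulMatrix b (algebraMap ℚ K x + algebraMap ℚ K y * δ) = !![x, q * y; y, x] := by
  have e : ∀ s t : ℚ, b.repr (algebraMap ℚ K s + algebraMap ℚ K t * δ) =
      Finsupp.single 0 s + Finsupp.single 1 t := by
    intro s t
    have : algebraMap ℚ K s + algebraMap ℚ K t * δ = s • b 0 + t • b 1 := by
      rw [h0, h1, Algebra.smul_def, Algebra.smul_def, mul_one]
    rw [this, map_add, map_smul, map_smul, b.repr_self, b.repr_self]
    simp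
  have hmul : (algebraMap ℚ K x + algebraMap ℚ K y * δ) * δ =
      algebraMap ℚ K (q * y) + algebraMap ℚ K x * δ := by
    rw [map_mul, ← hδ]
    ring
  ext i j
  rw [Algebra.leftMulMatrix_eq_repr_mul]
  fin_cases j
  · simp only [Fin.zero_eta, h0, mul_one, e]
    fin_cases i <;> simp
  · simp only [Fin.mk_one, h1, hmul, e]
    fin_cases i <;> simp

theorem trace_sqrt (hδ : δ ^ 2 = algebraMap ℚ K q) (hq : ¬ IsSquare q)
    (hK : Module.finrank ℚ K = 2) (x y : ℚ) :
    Algebra.trace ℚ K (algebraMap ℚ K x + algebraMap ℚ K y * δ) = 2 * x := by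
  obtain ⟨b, h0, h1⟩ := exists_basis_sqrt hδ hq hK
  rw [Algebra.trace_eq_matrix_trace b, leftMulMatrix_sqrt hδ h0 h1, Matrix.trace_fin_two]
  simp
  ring

theorem norm_sqrt (hδ : δ ^ 2 = algebraMap ℚ K q) (hq : ¬ IsSquare q)
    (hK : Module.finrank ℚ K = 2) (x y : ℚ) :
    Algebra.norm ℚ (algebraMap ℚ K x + algebraMap ℚ K y * δ) = x ^ 2 - q * y ^ 2 := by
  obtain ⟨b, h0, h1⟩ := exists_basis_sqrt hδ hq hK
  rw [Algebra.norm_eq_matrix_det b, leftMulMatrix_sqrt hδ h0 h1, Matrix.det_fin_two]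
  simp
  ring

/-- The discriminant of `ℚ(√q)` differs from `q` by the square of a rational number. By
Stickelberger's argument it has the form `t ^ 2 - 4 n`: for an integral basis `u, v` with
conjugates `u', v'`, one may take `t = u v' + v u'` and `n = u v' v u'`. -/
theorem discr_quadratic (hδ : δ ^ 2 = algebraMap ℚ K q) (hq : ¬ IsSquare q)
    (hK : Module.finrank ℚ K = 2) :
    (∃ w : ℚ, (NumberField.discr K : ℚ) = q * w ^ 2) ∧
      ∃ t n : ℤ, NumberField.discr K = t ^ 2 - 4 * n := by
  obtain ⟨b, h0, h1⟩ := exists_basis_sqrt hδ hq hK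
  have hrep : ∀ u : K, ∃ x y : ℚ, u = algebraMap ℚ K x + algebraMap ℚ K y * δ := by
    intro u
    refine ⟨b.repr u 0, b.repr u 1, ?_⟩
    conv_lhs => rw [← b.sum_repr u]
    rw [Fin.sum_univ_two, h0, h1, Algebra.smul_def, Algebra.smul_def, mul_one]
  have hcard : Fintype.card (Module.Free.ChooseBasisIndex ℤ (NumberField.RingOfIntegers K)) = 2 := by
    rw [← Module.finrank_eq_card_chooseBasisIndex, NumberField.RingOfIntegers.rank, hK]
  let e := Fintype.equivFinOfCardEq hcard
  let B : Fin 2 → K := NumberField.integralBasis K ∘ e.symm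
  have hBint : ∀ i, IsIntegral ℤ (B i) := by
    intro i
    change IsIntegral ℤ (NumberField.integralBasis K (e.symm i))
    rw [NumberField.integralBasis_apply]
    exact NumberField.RingOfIntegers.isIntegral_coe _
  have hD : (NumberField.discr K : ℚ) = Algebra.discr ℚ B := by
    rw [NumberField.coe_discr]
    exact (Algebra.discr_reindex ℚ (NumberField.integralBasis K) e).symm
  have hint : ∀ u : K, IsIntegral ℤ u → ∃ n : ℤ, Algebra.norm ℚ u = n := by
    intro u hu
    obtain ⟨n, hn⟩ := IsIntegrallyClosed.isIntegral_iff.1 (Algebra.isIntegral_norm ℚ hu)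
    exact ⟨n, hn.symm⟩
  obtain ⟨n0, hn0⟩ := hint _ (hBint 0)
  obtain ⟨n1, hn1⟩ := hint _ (hBint 1)
  obtain ⟨n2, hn2⟩ := hint _ ((hBint 0).add (hBint 1))
  obtain ⟨x0, y0, h0⟩ := hrep (B 0)
  obtain ⟨x1, y1, h1⟩ := hrep (B 1)
  have hmul : ∀ x y x' y' : ℚ, (algebraMap ℚ K x + algebraMap ℚ K y * δ) *
      (algebraMap ℚ K x' + algebraMap ℚ K y' * δ) =
      algebraMap ℚ K (x * x' + q * (y * y')) + algebraMap ℚ K (x * y' + y * x') * δ := by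
    intro x y x' y'
    simp only [map_add, map_mul, ← hδ]
    ring
  have hadd : B 0 + B 1 = algebraMap ℚ K (x0 + x1) + algebraMap ℚ K (y0 + y1) * δ := by
    rw [h0, h1, map_add, map_add]
    ring
  rw [h0, norm_sqrt hδ hq hK] at hn0
  rw [h1, norm_sqrt hδ hq hK] at hn1
  rw [hadd, norm_sqrt hδ hq hK] at hn2
  have hdet : Algebra.discr ℚ B = q * (2 * (x0 * y1 - x1 * y0)) ^ 2 := by
    rw [Algebra.discr_def, Matrix.det_fin_two]
    simp only [Algebra.traceMatrix_apply, Algebra.traceForm_apply, h0, h1, hmul,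
      trace_sqrt hδ hq hK]
    ring
  refine ⟨⟨_, hD.trans hdet⟩, n2 - n0 - n1, n0 * n1, ?_⟩
  have : ((NumberField.discr K : ℤ) : ℚ) = (((n2 - n0 - n1) ^ 2 - 4 * (n0 * n1) : ℤ) : ℚ) := by
    rw [hD, hdet]
    push_cast
    rw [← hn0, ← hn1, ← hn2]
    ring
  exact_mod_cast this

end Quadratic

theorem finrank_sqrtField (hsq : ¬ IsSquare (r : ℚ)) :
    Module.finrank ℚ (sqrtField r) = 2 := by
  obtain ⟨δ, hδ⟩ := IsAlgClosed.exists_pow_nat_eq (algebraMap ℚ Qbar r) two_pos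
  have h1 : sqrtField r = IntermediateField.adjoin ℚ {δ} := by
    refine le_antisymm (IntermediateField.adjoin_le_iff.2 fun x hx => ?_)
      (IntermediateField.adjoin.mono _ _ _ (by simpa using hδ))
    have hx' : x ^ 2 = algebraMap ℚ Qbar r := hx
    have hmem := IntermediateField.mem_adjoin_simple_self ℚ δ
    rcases sq_eq_sq_iff_eq_or_eq_neg.1 (hx'.trans hδ.symm) with rfl | rfl
    · exact hmem
    · exact neg_mem hmem
  have hirr : Irreducible (Polynomial.X ^ 2 - Polynomial.C (r : ℚ)) :=
    X_pow_sub_C_irreducible_of_prime Nat.prime_two fun b hb => hsq ⟨b, by rw [← hb, sq]⟩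
  have hmin : minpoly ℚ δ = Polynomial.X ^ 2 - Polynomial.C (r : ℚ) :=
    (minpoly.eq_of_irreducible_of_monic hirr (by simp [hδ])
      (Polynomial.monic_X_pow_sub_C _ two_ne_zero)).symm
  rw [h1]
  refine (IntermediateField.adjoin.finrank (Algebra.IsIntegral.isIntegral δ)).trans ?_
  rw [hmin, Polynomial.natDegree_X_pow_sub_C]

theorem disc_eq (hsq : ¬ IsSquare (r : ℚ)) :
    (∃ w : ℚ, (disc r : ℚ) = r * w ^ 2) ∧ ∃ t n : ℤ, disc r = t ^ 2 - 4 * n := by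
  obtain ⟨δ, hδ⟩ := IsAlgClosed.exists_pow_nat_eq (algebraMap ℚ Qbar r) two_pos
  refine discr_quadratic (δ := (⟨δ, IntermediateField.subset_adjoin _ _ hδ⟩ : sqrtField r)) ?_ hsq
    (finrank_sqrtField hsq)
  exact Subtype.ext hδ

theorem disc_ne_zero (r : ℚˣ) : disc r ≠ 0 := NumberField.discr_ne_zero _

/-! ### Square roots in cyclotomic fields -/

theorem absRep_mem_rootFixer {σ : Gal(Qbar/ℚ)} {m : ℕ} (hm : 0 < m) :
    absRep r σ ∈ rootFixer r m ↔ ∀ ζ : Qbar, ζ ^ m = 1 → σ ζ = ζ := by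
  constructor
  · intro h ζ hζ
    have hζ0 : ζ ≠ 0 := by
      rintro rfl
      rw [zero_pow hm.ne'] at hζ
      exact zero_ne_one hζ
    have hu : (Units.mk0 ζ hζ0) ^ m = 1 := Units.ext (by simpa using hζ)
    have := h ⟨Units.mk0 ζ hζ0, mem_radInf_of_pow_eq_one hm hu⟩ (Subtype.ext hu)
    have := congrArg (fun t : radInf r => ((t : Qbarˣ) : Qbar)) this
    simpa [coe_absRep] using this
  · intro h u hu
    refine radInf_ext ?_
    rw [coe_absRep]
    refine h _ ?_
    have := congrArg (fun t : radInf r => ((t : Qbarˣ) : Qbar)) (show u ^ m = 1 from hu)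
    simpa using this

/-- For an odd prime `p`, a square root of `p^* = ± p ≡ 1 mod 4` is given by a Gauss sum, an element
of `ℚ(ζ_p)`. -/
theorem exists_sqrt_prime {p : ℕ} (hp : p.Prime) (hodd : Odd p) :
    ∃ (s : ℤ) (γ : Qbar), s.natAbs = p ∧ s % 4 = 1 ∧ γ ^ 2 = (s : Qbar) ∧
      ∀ σ : Gal(Qbar/ℚ), (∀ ζ : Qbar, ζ ^ p = 1 → σ ζ = ζ) → σ γ = γ := by
  have : Fact p.Prime := ⟨hp⟩
  have hp2 : p ≠ 2 := by
    rintro rfl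
    exact absurd hodd (by decide)
  have hchar : ringChar (ZMod p) ≠ 2 := by rwa [ZMod.ringChar_zmod_n]
  obtain ⟨ζ, hζ⟩ := HasEnoughRootsOfUnity.exists_primitiveRoot Qbar p
  let χ : MulChar (ZMod p) Qbar := (quadraticChar (ZMod p)).ringHomComp (Int.castRingHom Qbar)
  let ψ : AddChar (ZMod p) Qbar := AddChar.zmodChar p hζ.pow_eq_one
  have hinj : Function.Injective (Int.castRingHom Qbar) := RingHom.injective_int _
  have hχ : χ ≠ 1 := (MulChar.ringHomComp_ne_one_iff hinj).2 (quadraticChar_ne_one hchar)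
  have hχ2 : χ.IsQuadratic := (quadraticChar_isQuadratic (ZMod p)).comp _
  have hψ : ψ.IsPrimitive := AddChar.zmodChar_primitive_of_primitive_root p hζ
  have hsq := gaussSum_sq hχ hχ2 hψ
  have hneg : χ (-1) = ((ZMod.χ₄ (p : ZMod 4) : ℤ) : Qbar) := by
    change ((quadraticChar (ZMod p) (-1) : ℤ) : Qbar) = _
    rw [quadraticChar_neg_one hchar, ZMod.card]
  refine ⟨ZMod.χ₄ (p : ZMod 4) * p, gaussSum χ ψ, ?_, ?_, ?_, fun σ hσ => ?_⟩
  · have h := ZMod.χ₄_nat_eq_if_mod_four p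
    rw [h, if_neg (by have := hodd; rw [Nat.odd_iff] at this; omega)]
    split_ifs <;> simp
  · have h := ZMod.χ₄_nat_eq_if_mod_four p
    have hp1 := Nat.odd_iff.1 hodd
    rw [h, if_neg (by omega)]
    split_ifs <;> omega
  · rw [hsq, hneg, ZMod.card]
    push_cast
    rfl
  · rw [gaussSum, map_sum]
    refine Finset.sum_congr rfl fun a _ => ?_
    rw [map_mul]
    congr 1
    · exact map_intCast σ _
    · change σ (AddChar.zmodChar p hζ.pow_eq_one a) = AddChar.zmodChar p hζ.pow_eq_one a
      rw [AddChar.zmodChar_apply, map_pow, hσ ζ hζ.pow_eq_one]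

theorem exists_sqrt_odd {n : ℕ} (hn : Odd n) :
    ∃ (s : ℤ) (γ : Qbar), s.natAbs = n ∧ s % 4 = 1 ∧ γ ^ 2 = (s : Qbar) ∧
      ∀ σ : Gal(Qbar/ℚ), (∀ p : ℕ, p.Prime → p ∣ n → ∀ ζ : Qbar, ζ ^ p = 1 → σ ζ = ζ) →
        σ γ = γ := by
  induction n using Nat.recOnMul with
  | zero => exact absurd hn (by decide)
  | one => exact ⟨1, 1, rfl, rfl, by simp, fun σ _ => map_one σ⟩
  | prime p hp =>
    obtain ⟨s, γ, h1, h2, h3, h4⟩ := exists_sqrt_prime hp hn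
    exact ⟨s, γ, h1, h2, h3, fun σ hσ => h4 σ (hσ p hp dvd_rfl)⟩
  | mul a b iha ihb =>
    obtain ⟨ha, hb⟩ := Nat.odd_mul.1 hn
    obtain ⟨s, γ, h1, h2, h3, h4⟩ := iha ha
    obtain ⟨s', γ', h1', h2', h3', h4'⟩ := ihb hb
    refine ⟨s * s', γ * γ', by rw [Int.natAbs_mul, h1, h1'], by rw [Int.mul_emod, h2, h2']; rfl,
      by rw [mul_pow, h3, h3', Int.cast_mul], fun σ hσ => ?_⟩
    rw [map_mul, h4 σ fun p hp hpa => hσ p hp (hpa.mul_right b),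
      h4' σ fun p hp hpb => hσ p hp (hpb.mul_left a)]

/-- If the discriminant `D` of `ℚ(√r)` is odd, then `√r` lies in the field generated by the
`p`-th roots of unity for the primes `p ∣ D`. -/
theorem sqrt_fixed_of_odd_disc (hsq : ¬ IsSquare (r : ℚ)) (hD : Odd (disc r)) {δ : Qbar}
    (hδ : δ ^ 2 = algebraMap ℚ Qbar r) {σ : Gal(Qbar/ℚ)}
    (hσ : ∀ p : ℕ, p.Prime → p ∣ (disc r).natAbs → absRep r σ ∈ rootFixer r p) : σ δ = δ := by
  obtain ⟨⟨w, hw⟩, t, n, htn⟩ := disc_eq hsq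
  obtain ⟨s, γ, hs, hs4, hγ, hfix⟩ := exists_sqrt_odd (Int.natAbs_odd.2 hD)
  have hD4 : disc r % 4 = 1 := by
    have ht : Odd t := by
      by_contra ht
      rw [Int.not_odd_iff_even] at ht
      obtain ⟨k, rfl⟩ := ht
      rw [htn] at hD
      exact (Int.not_odd_iff_even.2 ⟨2 * k ^ 2 - 2 * n, by ring⟩) hD
    obtain ⟨k, rfl⟩ := ht
    rw [htn]
    have : (2 * k + 1) ^ 2 - 4 * n = 1 + 4 * (k ^ 2 + k - n) := by ring
    rw [this]
    omega
  have hsD : s = disc r := by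
    rcases Int.natAbs_eq_natAbs_iff.1 hs with h | h
    · exact h
    · omega
  have hw0 : w ≠ 0 := by
    rintro rfl
    refine disc_ne_zero r ?_
    rw [zero_pow two_ne_zero, mul_zero] at hw
    exact_mod_cast hw
  have hw' : algebraMap ℚ Qbar w ≠ 0 := by simpa using hw0
  have hsq' : (δ * algebraMap ℚ Qbar w) ^ 2 = γ ^ 2 := by
    rw [mul_pow, hδ, hγ, hsD, ← map_pow, ← map_mul, ← hw, map_intCast]
  have hσγ : σ γ = γ := hfix σ fun p hp hpD =>
    (absRep_mem_rootFixer hp.pos).1 (hσ p hp hpD)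
  have hσδ : σ (δ * algebraMap ℚ Qbar w) = δ * algebraMap ℚ Qbar w := by
    rcases sq_eq_sq_iff_eq_or_eq_neg.1 hsq' with h | h
    · rw [h, hσγ]
    · rw [h, map_neg, hσγ]
  rw [map_mul, AlgEquiv.commutes] at hσδ
  exact mul_right_cancel₀ hw' hσδ

/-- If `√r` lies in the field of `m`-th roots of unity for an odd number `m`, then the discriminant
of `ℚ(√r)` is odd and its prime divisors divide `m`. -/
theorem disc_of_sqrt_fixed {m : ℕ} (hm : Odd m) {δ : Qbar} (hδ : δ ^ 2 = algebraMap ℚ Qbar r)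
    (hfix : ∀ σ : Gal(Qbar/ℚ), absRep r σ ∈ rootFixer r m → σ δ = δ) :
    Odd (disc r) ∧ ∀ p : ℕ, p.Prime → p ∣ (disc r).natAbs → p ∣ m := by
  have : NeZero m := ⟨hm.pos.ne'⟩
  obtain ⟨ζ, hζ⟩ := HasEnoughRootsOfUnity.exists_primitiveRoot Qbar m
  let E : IntermediateField ℚ Qbar := IntermediateField.adjoin ℚ {ζ}
  have hδE : δ ∈ E := by
    rw [← InfiniteGalois.fixedField_fixingSubgroup E]
    rintro ⟨σ, hσ⟩
    refine hfix σ ((absRep_mem_rootFixer hm.pos).2 fun ξ hξ => ?_)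
    obtain ⟨i, -, rfl⟩ := hζ.eq_pow_of_pow_eq_one hξ
    rw [map_pow, (IntermediateField.mem_fixingSubgroup_iff _ _).1 hσ ζ
      (IntermediateField.mem_adjoin_simple_self ℚ ζ)]
  have hle : sqrtField r ≤ E := IntermediateField.adjoin_le_iff.2 fun x hx => by
    have hx' : x ^ 2 = algebraMap ℚ Qbar r := hx
    rcases sq_eq_sq_iff_eq_or_eq_neg.1 (hx'.trans hδ.symm) with rfl | rfl
    · exact hδE
    · exact neg_mem hδE
  have hcyc : IsCyclotomicExtension {m} ℚ E := hζ.intermediateField_adjoin_isCyclotomicExtension ℚ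
  have hNF : NumberField E := IsCyclotomicExtension.numberField {m} ℚ E
  let _ : Algebra (sqrtField r) E := (IntermediateField.inclusion hle).toRingHom.toAlgebra
  have hdvd : disc r ∣ NumberField.discr E := NumberField.discr_dvd_discr (sqrtField r) E
  have hdvd' : (disc r).natAbs ∣ m ^ m.totient := by
    refine (Int.natAbs_dvd_natAbs.2 hdvd).trans ?_
    rw [IsCyclotomicExtension.Rat.natAbs_discr m E]
    exact Nat.div_dvd_of_dvd (Nat.prod_primeFactors_pow_totient_ediv_dvd hm.pos)
  refine ⟨Int.natAbs_odd.1 (Odd.of_dvd_nat hm.pow hdvd'), fun p hp hpD => ?_⟩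
  exact hp.dvd_of_dvd_pow (hpD.trans hdvd')

/-! ### The entanglement of the fields `F_p` -/

theorem apply_sqrt_sq {δ : radInf r} (hδ : (δ : Qbarˣ) ^ 2 = ratUnits r) (a : A r) :
    a.1 δ ^ 2 = δ ^ 2 := by
  rw [← map_pow]
  refine a.2 _ ⟨r, ?_⟩
  rw [← hδ]
  rfl

theorem coe_sqrt_sq {δ : radInf r} (hδ : (δ : Qbarˣ) ^ 2 = ratUnits r) :
    ((δ : Qbarˣ) : Qbar) ^ 2 = algebraMap ℚ Qbar r :=
  congrArg (fun t : Qbarˣ => (t : Qbar)) hδ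

/-- The Galois group moves `√r`. -/
theorem exists_absRep_sqrt_ne (hsq : ¬ IsSquare (r : ℚ)) {δ : radInf r}
    (hδ : (δ : Qbarˣ) ^ 2 = ratUnits r) : ∃ σ, (absRep r σ).1 δ ≠ δ := by
  by_contra! hcon
  have hbot : ((δ : Qbarˣ) : Qbar) ∈ (⊥ : IntermediateField ℚ Qbar) := by
    refine (InfiniteGalois.mem_bot_iff_fixed _).2 fun σ => ?_
    rw [← coe_absRep, hcon σ]
  obtain ⟨q, hq⟩ := IntermediateField.mem_bot.1 hbot
  refine hsq ⟨q, (algebraMap ℚ Qbar).injective ?_⟩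
  rw [← coe_sqrt_sq hδ, ← hq, map_mul, sq]

/-- The prime number `2`. -/
abbrev primeTwo : Nat.Primes := ⟨2, Nat.prime_two⟩

/-- The set `T` contains `2` and all prime divisors of `D`, and `D` is odd. This is the condition
for `√r` to cause a dependence between the fields `F_p` with `p ∈ T`. -/
def IsEntangled (r : ℚˣ) (T : Finset Nat.Primes) : Prop :=
  Odd (disc r) ∧ primeTwo ∈ T ∧ ∀ p : Nat.Primes, (p : ℕ) ∣ (disc r).natAbs → p ∈ T

/-- A power of an element fixing the `p`-th roots of unity fixes `R_p` if the exponent is divisible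
by `p`, since the elements fixing these roots act on `R_p` through a group of exponent `p`. -/
theorem pow_mem_radFixer {a : A r} {p m : ℕ} (ha : a ∈ rootFixer r p) (hpm : p ∣ m) :
    a ^ m ∈ radFixer r p := by
  intro x hx
  have hu : (a.1 x / x) ^ p = 1 := apply_div_pow a x hx
  have key : ∀ j : ℕ, (a ^ j).1 x = (a.1 x / x) ^ j * x := by
    intro j
    induction j with
    | zero => simp
    | succ j ih =>
      rw [pow_succ', mul_apply, ih, map_mul, map_pow, ha _ hu, pow_succ, mul_assoc, div_mul_cancel]
  obtain ⟨k, rfl⟩ := hpm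
  rw [key, pow_mul, hu, one_pow, one_mul]

theorem prod_radFixer_le (T : Finset Nat.Primes) :
    radFixer r (∏ p ∈ T, (p : ℕ)) ≤ finsetFixer r T := fun _ ha =>
  mem_finsetFixer.2 fun _ hp => radFixer_anti (Finset.dvd_prod_of_mem _ hp) ha

/-- If `√r` does not lie in the field of `p`-th roots of unity for the odd primes `p ∈ T`, some
element of the Galois group moves `√r` and is trivial on `R_p` for these `p`. -/
theorem exists_absRep_sqrt_ne_of_not_isEntangled {T : Finset Nat.Primes} (hT : ¬ IsEntangled r T)
    (h2T : primeTwo ∈ T) {δ : radInf r} (hδ : (δ : Qbarˣ) ^ 2 = ratUnits r) :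
    ∃ σ, (absRep r σ).1 δ ≠ δ ∧ ∀ p ∈ T, p ≠ primeTwo → absRep r σ ∈ radFixer r p := by
  classical
  set m := ∏ p ∈ T.erase primeTwo, (p : ℕ) with hm
  have hmodd : Odd m := by
    refine Finset.prod_induction _ Odd (fun _ _ => Odd.mul) odd_one fun p hp => ?_
    exact p.2.odd_of_ne_two fun h => (Finset.mem_erase.1 hp).1 (Subtype.ext h)
  obtain ⟨σ, hσ, hσδ⟩ : ∃ σ, absRep r σ ∈ rootFixer r m ∧ (absRep r σ).1 δ ≠ δ := by
    by_contra! hcon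
    obtain ⟨hD, hDm⟩ := disc_of_sqrt_fixed hmodd (coe_sqrt_sq hδ) fun σ hσ => by
      rw [← coe_absRep, hcon σ hσ]
    refine hT ⟨hD, h2T, fun p hp => ?_⟩
    obtain ⟨q, hq, hpq⟩ := (Prime.dvd_finsetProd_iff p.2.prime _).1 (hDm p p.2 hp)
    have : p = q := Subtype.ext ((Nat.prime_dvd_prime_iff_eq p.2 q.2).1 hpq)
    exact this ▸ Finset.mem_of_mem_erase hq
  refine ⟨σ ^ m, ?_, fun p hp hp2 => ?_⟩
  · -- `σ ^ m` acts on `√r` as `σ`, because `m` is odd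
    have hδ2 : (δ : Qbarˣ) ∈ rad r 2 := mem_rad_of_pow_eq hδ
    have h2 : absRep r σ ∈ rootFixer r 2 := (absRep_mem_rootFixer two_pos).2 fun ζ hζ => by
      rcases sq_eq_sq_iff_eq_or_eq_neg.1 (hζ.trans (one_pow 2).symm) with rfl | rfl <;> simp
    obtain ⟨k, hk⟩ := hmodd
    have h3 : ((absRep r σ) ^ (2 * k)).1 δ = δ := pow_mem_radFixer h2 (dvd_mul_right 2 k) δ hδ2
    rwa [map_pow, hk, pow_succ', mul_apply, h3]
  · have hpm : (p : ℕ) ∣ m := Finset.dvd_prod_of_mem _ (Finset.mem_erase.2 ⟨hp2, hp⟩)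
    rw [map_pow]
    exact pow_mem_radFixer (rootFixer_anti hpm hσ) hpm

/-- Unless `T` is entangled, every element of `A` agrees on the groups `R_p` with `p ∈ T` with an
element of the Galois group. -/
theorem G_sup_finsetFixer (hr : (r : ℚ) ≠ -1) (hsq : ¬ IsSquare (r : ℚ)) {T : Finset Nat.Primes}
    (hT : ¬ IsEntangled r T) : G r ⊔ finsetFixer r T = ⊤ := by
  have hr1 : (r : ℚ) ≠ 1 := fun h => hsq ⟨1, by rw [h, one_mul]⟩
  obtain ⟨ρ, h, β, hβ⟩ := exists_isSqrtGenerator hr1 hr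
  set n := ∏ p ∈ T, (p : ℕ)
  have hn0 : 0 < n := Finset.prod_pos fun p _ => p.2.pos
  -- the elements that fix `β` and the `4 n`-th roots of unity
  have hfix : ∀ b : A r, b ∈ rootFixer r (4 * n) → b.1 β = β → b ∈ G r ⊔ finsetFixer r T := by
    intro b hb hbβ
    obtain ⟨τ, hτ⟩ := exists_absRep_inv_mul_mem_radFixer hβ hn0 hb hbβ
    rw [← mul_inv_cancel_left (absRep r τ) b]
    exact mul_mem (Subgroup.mem_sup_left (absRep_mem_G τ))
      (Subgroup.mem_sup_right (prod_radFixer_le T hτ))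
  refine (Subgroup.eq_top_iff' _).2 fun a => ?_
  obtain ⟨σ, hσ⟩ := exists_absRep_inv_mul_mem_rootFixer a (M := 4 * n) (by positivity)
  rw [← mul_inv_cancel_left (absRep r σ) a]
  refine mul_mem (Subgroup.mem_sup_left (absRep_mem_G σ)) ?_
  set b := (absRep r σ)⁻¹ * a
  -- the `2`-component `k` of `b` acts on `β` and on the `4 n`-th roots of unity as `b`
  obtain ⟨k, hk1, hk2⟩ := exists_component b Nat.prime_two
  have hkβ : k.1 β = b.1 β := hk1 β 1 (by rw [pow_one, div_pow, hβ.apply_sq, div_self'])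
  have hkroot : k ∈ rootFixer r (4 * n) := fun u hu =>
    hk2 u 1 (Nat.coprime_one_left 2) (by rw [hσ u hu, div_self', one_pow])
  have hkp : ∀ p : Nat.Primes, p ≠ primeTwo → k ∈ radFixer r p := fun p hp x hx =>
    hk2 x p ((Nat.coprime_primes p.2 Nat.prime_two).2 fun h => hp (Subtype.ext h))
      (apply_div_pow b x hx)
  rw [← mul_inv_cancel_left k b]
  refine mul_mem ?_ (hfix _ (mul_mem (inv_mem hkroot) hσ) (by rw [mul_apply, inv_apply_eq, hkβ]))
  by_cases h2T : primeTwo ∈ T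
  swap
  · exact Subgroup.mem_sup_right (mem_finsetFixer.2 fun p hp => hkp p fun h => h2T (h ▸ hp))
  obtain ⟨δ, hδ⟩ := exists_root r two_pos
  have hk2root : k ∈ rootFixer r 2 := rootFixer_anti ⟨2 * n, by ring⟩ hkroot
  by_cases hkδ : k.1 δ = δ
  · refine Subgroup.mem_sup_right (mem_finsetFixer.2 fun p hp => ?_)
    by_cases hp2 : p = primeTwo
    · subst hp2
      exact mem_radFixer hδ hk2root hkδ
    · exact hkp p hp2
  · obtain ⟨τ, hτδ, hτ⟩ := exists_absRep_sqrt_ne_of_not_isEntangled hT h2T hδ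
    rw [← mul_inv_cancel_left (absRep r τ) k]
    refine mul_mem (Subgroup.mem_sup_left (absRep_mem_G τ))
      (Subgroup.mem_sup_right (mem_finsetFixer.2 fun p hp => ?_))
    by_cases hp2 : p = primeTwo
    · subst hp2
      refine mem_radFixer hδ (mul_mem (inv_mem ?_) hk2root) ?_
      · refine (absRep_mem_rootFixer two_pos).2 fun ζ hζ => ?_
        rcases sq_eq_sq_iff_eq_or_eq_neg.1 (hζ.trans (one_pow 2).symm) with rfl | rfl <;> simp
      · rw [mul_apply, inv_apply_eq]
        exact apply_eq_of_ne (apply_sqrt_sq hδ) hkδ hτδ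
    · exact mul_mem (inv_mem (hτ p hp hp2)) (hkp p hp2)

/-- If `T` is entangled, the elements of `A` that agree with an element of the Galois group on the
groups `R_p` with `p ∈ T` form a subgroup of index two. -/
theorem index_G_sup_finsetFixer (hr : (r : ℚ) ≠ -1) (hsq : ¬ IsSquare (r : ℚ))
    {T : Finset Nat.Primes} (hT : IsEntangled r T) : (G r ⊔ finsetFixer r T).index = 2 := by
  have hr1 : (r : ℚ) ≠ 1 := fun h => hsq ⟨1, by rw [h, one_mul]⟩
  have hdvd : (G r ⊔ finsetFixer r T).index ∣ 2 :=
    (Subgroup.index_dvd_of_le le_sup_left).trans (by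
      rcases G_index hr1 hr with h | h <;> rw [h]
      exact one_dvd 2)
  rcases (Nat.dvd_prime Nat.prime_two).1 hdvd with h | h
  swap
  · exact h
  exfalso
  rw [Subgroup.index_eq_one] at h
  obtain ⟨hD, h2T, hDT⟩ := hT
  obtain ⟨δ, hδ⟩ := exists_root r two_pos
  have hδ2 : (δ : Qbarˣ) ∈ rad r 2 := mem_rad_of_pow_eq hδ
  obtain ⟨σ, hσ⟩ := exists_absRep_sqrt_ne hsq hδ
  -- the `2`-component of `σ` moves `√r` and fixes the roots of unity of odd order
  obtain ⟨k, hk1, hk2⟩ := exists_component (absRep r σ) Nat.prime_two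
  have hkδ : k.1 δ ≠ δ := by
    rwa [hk1 δ 1 (by rw [pow_one]; exact apply_div_pow _ δ hδ2)]
  have hmem : k ∈ G r ⊔ finsetFixer r T := h ▸ Subgroup.mem_top k
  rw [← SetLike.mem_coe, Subgroup.mul_normal] at hmem
  obtain ⟨g, hg, t, ht, hgt⟩ := hmem
  rw [SetLike.mem_coe, ← range_absRep] at hg
  obtain ⟨τ, rfl⟩ := hg
  have ht' := mem_finsetFixer.1 ht
  have hτδ : τ ((δ : Qbarˣ) : Qbar) = ((δ : Qbarˣ) : Qbar) := by
    refine sqrt_fixed_of_odd_disc hsq hD (coe_sqrt_sq hδ) fun p hp hpD => ?_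
    have hpodd : Odd p := Odd.of_dvd_nat (Int.natAbs_odd.2 hD) hpD
    have hkp : k ∈ rootFixer r p := radFixer_le_rootFixer p fun x hx =>
      hk2 x p (Nat.coprime_two_right.2 hpodd) (apply_div_pow _ x hx)
    have hτ : absRep r τ = k * t⁻¹ := by rw [← hgt, mul_inv_cancel_right]
    rw [hτ]
    exact mul_mem hkp (inv_mem (radFixer_le_rootFixer p (ht' ⟨p, hp⟩ (hDT ⟨p, hp⟩ hpD))))
  refine hkδ ?_
  rw [← hgt, mul_apply, ht' _ h2T δ hδ2]
  exact radInf_ext (by rw [coe_absRep, hτδ])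

/-- The discriminant of `ℚ(√r)` has a prime divisor, so a single prime is never entangled. -/
theorem not_isEntangled_singleton (hsq : ¬ IsSquare (r : ℚ)) (p : Nat.Primes) :
    ¬ IsEntangled r {p} := by
  rintro ⟨hD, h2, hDT⟩
  rw [Finset.mem_singleton] at h2
  obtain ⟨δ, hδ⟩ := exists_root r two_pos
  obtain ⟨σ, hσ⟩ := exists_absRep_sqrt_ne hsq hδ
  refine hσ (radInf_ext ?_)
  rw [coe_absRep]
  refine sqrt_fixed_of_odd_disc hsq hD (coe_sqrt_sq hδ) fun q hq hqD => ?_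
  have hqp : (⟨q, hq⟩ : Nat.Primes) = p := Finset.mem_singleton.1 (hDT ⟨q, hq⟩ hqD)
  have hq2 : q = 2 := congrArg Subtype.val (hqp.trans h2.symm)
  subst hq2
  exact absurd (Odd.of_dvd_nat (Int.natAbs_odd.2 hD) hqD) (by decide)

/-! ### The degrees of the fields `F_p` -/

theorem F_eq_adjoin {n : ℕ} (hn : 0 < n) {ζ α : Qbar} (hζ : IsPrimitiveRoot ζ n)
    (hα : α ^ n = algebraMap ℚ Qbar r) : F r n = IntermediateField.adjoin ℚ {ζ, α} := by
  have hα0 : α ≠ 0 := by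
    rintro rfl
    rw [zero_pow hn.ne'] at hα
    exact r.ne_zero ((algebraMap ℚ Qbar).injective (by rw [← hα, map_zero]))
  have hζu := hζ.isUnit hn.ne'
  refine le_antisymm (IntermediateField.adjoin_le_iff.2 ?_) (IntermediateField.adjoin_le_iff.2 ?_)
  · rintro _ ⟨x, ⟨i, hi⟩, rfl⟩
    have hx : ((x : Qbar) / α ^ i) ^ n = 1 := by
      have h1 := congrArg (fun t : Qbarˣ => (t : Qbar)) hi
      simp only [Units.val_pow_eq_pow_val, Units.val_zpow_eq_zpow_val] at h1
      have h2 : (α ^ i) ^ n = (x : Qbar) ^ n := by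
        rw [← h1, ← zpow_natCast, zpow_comm, zpow_natCast, hα]
        rfl
      rw [div_pow, h2, div_self (pow_ne_zero _ x.ne_zero)]
    have : NeZero n := ⟨hn.ne'⟩
    obtain ⟨j, -, hj⟩ := hζ.eq_pow_of_pow_eq_one hx
    have hx' : (x : Qbar) = ζ ^ j * α ^ i := by
      rw [hj, div_mul_cancel₀ _ (zpow_ne_zero _ hα0)]
    change (x : Qbar) ∈ IntermediateField.adjoin ℚ {ζ, α}
    rw [hx']
    exact mul_mem (pow_mem (IntermediateField.subset_adjoin _ _ (by simp)) _)
      (zpow_mem (IntermediateField.subset_adjoin _ _ (by simp)) _)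
  · rintro x (rfl | rfl)
    · obtain ⟨u, rfl⟩ := hζu
      refine IntermediateField.subset_adjoin _ _ ⟨u, ?_, rfl⟩
      change u ^ n ∈ base r
      rw [Units.ext (by simpa using hζ.pow_eq_one : ((u ^ n : Qbarˣ) : Qbar) = (1 : Qbarˣ))]
      exact (base r).one_mem
    · refine IntermediateField.subset_adjoin _ _ ⟨Units.mk0 x hα0, ?_, rfl⟩
      exact mem_rad_of_pow_eq (Units.ext hα)

theorem finiteDimensional_F {n : ℕ} (hn : 0 < n) : FiniteDimensional ℚ (F r n) := by
  have : NeZero n := ⟨hn.ne'⟩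
  obtain ⟨ζ, hζ⟩ := HasEnoughRootsOfUnity.exists_primitiveRoot Qbar n
  obtain ⟨α, hα⟩ := IsAlgClosed.exists_pow_nat_eq (algebraMap ℚ Qbar r) hn
  rw [F_eq_adjoin hn hζ hα]
  exact IntermediateField.finiteDimensional_adjoin fun x _ => Algebra.IsIntegral.isIntegral x

/-- The action of the Galois group on `R_n` is that of `Gal(F_n/ℚ)`. -/
theorem index_comap_radFixer {n : ℕ} (hn : 0 < n) :
    ((radFixer r n).comap (absRep r)).index = Module.finrank ℚ (F r n) := by
  have := finiteDimensional_F (r := r) hn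
  have hcoe : ∀ (σ : Gal(Qbar/ℚ)) (y : F r n),
      ((AlgEquiv.restrictNormalHom (F r n) σ y : F r n) : Qbar) = σ (y : Qbar) :=
    fun σ y => AlgEquiv.restrictNormal_commutes σ (F r n) y
  have hker : (radFixer r n).comap (absRep r) = (AlgEquiv.restrictNormalHom (F r n)).ker := by
    ext σ
    rw [MonoidHom.mem_ker, Subgroup.mem_comap]
    constructor
    · intro h
      refine AlgEquiv.ext fun y => Subtype.ext ?_
      rw [hcoe]
      change σ (y : Qbar) = y
      refine IntermediateField.adjoin_induction ℚ (p := fun y _ => σ y = y) ?_ σ.commutes ?_ ?_ ?_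
        y.2
      · rintro _ ⟨x, hx, rfl⟩
        have := h ⟨x, n, hn, hx⟩ hx
        rw [← coe_absRep σ ⟨x, n, hn, hx⟩, this]
      · intro x y _ _ hx hy
        rw [map_add, hx, hy]
      · intro x _ hx
        rw [map_inv₀, hx]
      · intro x y _ _ hx hy
        rw [map_mul, hx, hy]
    · intro h x hx
      refine radInf_ext ?_
      rw [coe_absRep]
      have := hcoe σ ⟨_, IntermediateField.subset_adjoin _ _ ⟨x, hx, rfl⟩⟩
      rw [h] at this
      exact this.symm
  rw [hker, Subgroup.index_ker, MonoidHom.range_eq_top.2 (AlgEquiv.restrictNormalHom_surjective Qbar)]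
  have : IsGalois ℚ (F r n) := ⟨⟩
  rw [Subgroup.card_top]
  exact IsGalois.card_aut_eq_finrank ℚ (F r n)

theorem index_radFixer (hr : (r : ℚ) ≠ -1) (hsq : ¬ IsSquare (r : ℚ)) (p : Nat.Primes) :
    (radFixer r p).index = Module.finrank ℚ (F r p) := by
  have h1 : G r ⊔ radFixer r p = ⊤ := by
    have := G_sup_finsetFixer hr hsq (not_isEntangled_singleton hsq p)
    simpa [finsetFixer] using this
  rw [← index_comap_radFixer p.2.pos, Subgroup.index_comap, range_absRep,
    ← Subgroup.relIndex_sup_right, h1, Subgroup.relIndex_top_right]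

theorem finrank_adjoin_primitiveRoot {p : ℕ} (hp : p.Prime) {ζ : Qbar} (hζ : IsPrimitiveRoot ζ p) :
    Module.finrank ℚ (IntermediateField.adjoin ℚ {ζ}) = p - 1 := by
  refine (IntermediateField.adjoin.finrank (Algebra.IsIntegral.isIntegral ζ)).trans ?_
  rw [← Polynomial.cyclotomic_eq_minpoly_rat hζ hp.pos, Polynomial.natDegree_cyclotomic,
    Nat.totient_prime hp]

theorem finrank_F_of_pow {p : ℕ} (hp : p.Prime) {s : ℚ} (hs : s ^ p = r) :
    Module.finrank ℚ (F r p) = p - 1 := by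
  have : NeZero p := ⟨hp.ne_zero⟩
  obtain ⟨ζ, hζ⟩ := HasEnoughRootsOfUnity.exists_primitiveRoot Qbar p
  have h : F r p = IntermediateField.adjoin ℚ {ζ} := by
    rw [F_eq_adjoin hp.pos hζ (α := algebraMap ℚ Qbar s) (by rw [← map_pow, hs])]
    refine le_antisymm (IntermediateField.adjoin_le_iff.2 ?_)
      (IntermediateField.adjoin.mono _ _ _ (by simp))
    rintro x (rfl | rfl)
    · exact IntermediateField.mem_adjoin_simple_self ℚ _
    · exact IntermediateField.algebraMap_mem _ s
  rw [h, finrank_adjoin_primitiveRoot hp hζ]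

theorem finrank_F_of_not_pow {p : ℕ} (hp : p.Prime) (hs : ∀ s : ℚ, s ^ p ≠ r) :
    Module.finrank ℚ (F r p) = p * (p - 1) := by
  have : NeZero p := ⟨hp.ne_zero⟩
  obtain ⟨ζ, hζ⟩ := HasEnoughRootsOfUnity.exists_primitiveRoot Qbar p
  obtain ⟨α, hα⟩ := IsAlgClosed.exists_pow_nat_eq (algebraMap ℚ Qbar r) hp.pos
  have hmin : minpoly ℚ α = Polynomial.X ^ p - Polynomial.C (r : ℚ) :=
    (minpoly.eq_of_irreducible_of_monic (X_pow_sub_C_irreducible_of_prime hp hs) (by simp [hα])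
      (Polynomial.monic_X_pow_sub_C _ hp.ne_zero)).symm
  have h1 : Module.finrank ℚ (IntermediateField.adjoin ℚ {α}) = p := by
    refine (IntermediateField.adjoin.finrank (Algebra.IsIntegral.isIntegral α)).trans ?_
    rw [hmin, Polynomial.natDegree_X_pow_sub_C]
  have h2 := finrank_adjoin_primitiveRoot hp hζ
  have hcop : p.Coprime (p - 1) := by
    rw [Nat.coprime_self_sub_right hp.one_le]
    exact Nat.coprime_one_right p
  have hsup : F r p = IntermediateField.adjoin ℚ {α} ⊔ IntermediateField.adjoin ℚ {ζ} := by
    rw [F_eq_adjoin hp.pos hζ hα, ← IntermediateField.adjoin_union, Set.singleton_union,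
      Set.pair_comm]
  have hld : (IntermediateField.adjoin ℚ {α}).LinearDisjoint (IntermediateField.adjoin ℚ {ζ}) :=
    IntermediateField.LinearDisjoint.of_finrank_coprime (by rw [h1, h2]; exact hcop)
  rw [hsup]
  refine hld.finrank_sup.trans ?_
  rw [h1, h2]

theorem one_lt_finrank_F (hsq : ¬ IsSquare (r : ℚ)) {p : ℕ} (hp : p.Prime) :
    1 < Module.finrank ℚ (F r p) := by
  by_cases h : ∃ s : ℚ, s ^ p = r
  · obtain ⟨s, hs⟩ := h
    rw [finrank_F_of_pow hp hs]
    have : p ≠ 2 := by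
      rintro rfl
      exact hsq ⟨s, by rw [← hs, sq]⟩
    have := hp.two_le
    omega
  · rw [finrank_F_of_not_pow hp (not_exists.1 h)]
    have := hp.two_le
    exact lt_of_lt_of_le (by omega) (Nat.le_mul_of_pos_right p (by omega))

theorem finrank_F_two (hsq : ¬ IsSquare (r : ℚ)) : Module.finrank ℚ (F r 2) = 2 :=
  finrank_F_of_not_pow Nat.prime_two fun s hs => hsq ⟨s, by rw [← hs, sq]⟩

/-! ### The largest exponent -/

theorem exists_isGreatest_exponent (hr : (r : ℚ) ≠ -1) (hsq : ¬ IsSquare (r : ℚ)) :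
    ∃ h : ℕ, IsGreatest {k : ℕ | ∃ s : ℚ, s ^ k = r} h := by
  have hr1 : (r : ℚ) ≠ 1 := fun h => hsq ⟨1, by rw [h, one_mul]⟩
  have hfin : {k : ℕ | ∃ s : ℚ, s ^ k = r}.Finite := by
    refine (Set.finite_Iic ((r : ℚ).num.natAbs + (r : ℚ).den)).subset ?_
    rintro k ⟨s, hs⟩
    exact exponent_le r.ne_zero hr1 hr hs
  obtain ⟨h, hh⟩ := hfin.exists_maximal ⟨1, (r : ℚ), pow_one _⟩
  refine ⟨h, hh.1, fun k hk => ?_⟩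
  rcases le_total k h with hle | hle
  · exact hle
  · exact hh.2 hk hle

theorem prime_dvd_exponent_iff {h : ℕ} (hh : IsGreatest {k : ℕ | ∃ s : ℚ, s ^ k = r} h)
    {p : ℕ} (hp : p.Prime) : p ∣ h ↔ ∃ s : ℚ, s ^ p = r := by
  obtain ⟨⟨t, ht⟩, hmax⟩ := hh
  constructor
  · rintro ⟨k, rfl⟩
    exact ⟨t ^ k, by rw [← pow_mul, mul_comm, ht]⟩
  · rintro ⟨s, hs⟩
    by_contra hndvd
    have hpos : 0 < h := hmax ⟨(r : ℚ), pow_one _⟩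
    have hr0 : (r : ℚ) ≠ 0 := r.ne_zero
    have hcop : (p : ℤ).gcd h = 1 := by
      exact_mod_cast (Nat.Prime.coprime_iff_not_dvd hp).2 hndvd
    obtain ⟨u, v, huv⟩ := Int.isCoprime_iff_gcd_eq_one.2 hcop
    -- a `p`-th and `h`-th power is a `p h`-th power, as `p` and `h` are coprime
    have hpow : (s ^ v * t ^ u) ^ (p * h) = (r : ℚ) := by
      have h1 : (s ^ v) ^ (p * h) = (r : ℚ) ^ (v * h) := by
        rw [← zpow_natCast, ← zpow_mul, Nat.cast_mul, mul_left_comm, zpow_mul, zpow_natCast, hs]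
      have h2 : (t ^ u) ^ (p * h) = (r : ℚ) ^ (u * p) := by
        rw [← zpow_natCast, ← zpow_mul, Nat.cast_mul, ← mul_assoc, mul_comm, zpow_mul,
          zpow_natCast, ht]
      rw [mul_pow, h1, h2, ← zpow_add₀ hr0, add_comm, huv, zpow_one]
    have := hmax ⟨_, hpow⟩
    have := hp.two_le
    nlinarith

theorem finrank_F_of_dvd {h : ℕ} (hh : IsGreatest {k : ℕ | ∃ s : ℚ, s ^ k = r} h)
    {p : ℕ} (hp : p.Prime) (hph : p ∣ h) : (Module.finrank ℚ (F r p) : ℝ) = p - 1 := by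
  obtain ⟨s, hs⟩ := (prime_dvd_exponent_iff hh hp).1 hph
  rw [finrank_F_of_pow hp hs, Nat.cast_sub hp.one_le, Nat.cast_one]

theorem finrank_F_of_not_dvd {h : ℕ} (hh : IsGreatest {k : ℕ | ∃ s : ℚ, s ^ k = r} h)
    {p : ℕ} (hp : p.Prime) (hph : ¬ p ∣ h) :
    (Module.finrank ℚ (F r p) : ℝ) = p * (p - 1) := by
  rw [finrank_F_of_not_pow hp fun s hs => hph ((prime_dvd_exponent_iff hh hp).2 ⟨s, hs⟩),
    Nat.cast_mul, Nat.cast_sub hp.one_le, Nat.cast_one]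

/-! ### Haar measure -/

instance (r : ℚˣ) : (nu r).IsHaarMeasure := by
  unfold nu
  infer_instance

instance (r : ℚˣ) : IsProbabilityMeasure (nu r) :=
  ⟨Measure.haarMeasure_self (K₀ := (⊤ : TopologicalSpace.PositiveCompacts (A r)))⟩

theorem nu_real_subgroup (H : Subgroup (A r)) (hH : H.index ≠ 0)
    (hmeas : MeasurableSet (H : Set (A r))) : (nu r).real H = 1 / H.index := by
  have : H.FiniteIndex := ⟨hH⟩
  have h1 := congrArg ENNReal.toReal (H.index_mul_measure hmeas (nu r))
  rw [measure_univ, ENNReal.toReal_mul, ENNReal.toReal_natCast, ENNReal.toReal_one] at h1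
  rw [eq_div_iff (by exact_mod_cast hH), mul_comm]
  exact h1

theorem measurableSet_radFixer (n : ℕ) : MeasurableSet (radFixer r n : Set (A r)) :=
  (isClosed_fixer _).measurableSet

theorem measurableSet_finsetFixer (T : Finset Nat.Primes) :
    MeasurableSet (finsetFixer r T : Set (A r)) := by
  rw [coe_finsetFixer]
  exact T.measurableSet_biInter fun p _ => measurableSet_radFixer p

theorem artinSet_eq (r : ℚˣ) : artinSet r = ⋂ p : Nat.Primes, (radFixer r p : Set (A r))ᶜ := by
  ext a
  rw [Set.mem_iInter]
  refine forall_congr' fun p => not_congr ?_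
  rw [MonoidHom.mem_ker]
  constructor
  · intro h x hx
    have := congrArg (fun b : Afin r p => (((b.1 ⟨x, hx⟩ : rad r p) : Qbarˣ))) h
    exact Subtype.ext this
  · intro h
    refine Subtype.ext (MulEquiv.ext fun x => Subtype.ext ?_)
    have := h ⟨x, radPrimePow_le_radInf r p.2.pos (rad_le_radPrimePow r p x.2)⟩ x.2
    exact congrArg (fun t : radInf r => (t : Qbarˣ)) this

/-- Inclusion-exclusion for the intersection of finitely many complements. -/
theorem measureReal_inter_biInter_compl {X ι : Type*} [MeasurableSpace X] [DecidableEq ι]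
    (μ : Measure X) [IsFiniteMeasure μ] {K : ι → Set X} (hK : ∀ i, MeasurableSet (K i))
    (P : Finset ι) (B : Set X) :
    μ.real (B ∩ ⋂ i ∈ P, (K i)ᶜ) =
      ∑ T ∈ P.powerset, (-1) ^ T.card * μ.real (B ∩ ⋂ i ∈ T, K i) := by
  induction P using Finset.induction_on generalizing B with
  | empty => simp
  | insert i P hi ih =>
    have h1 : B ∩ ⋂ j ∈ insert i P, (K j)ᶜ = (B ∩ ⋂ j ∈ P, (K j)ᶜ) \ K i := by
      rw [Finset.set_biInter_insert, Set.sdiff_eq]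
      ac_rfl
    have h2 : (B ∩ ⋂ j ∈ P, (K j)ᶜ) ∩ K i = (B ∩ K i) ∩ ⋂ j ∈ P, (K j)ᶜ := by ac_rfl
    have h3 := measureReal_inter_add_sdiff (μ := μ) (s := B ∩ ⋂ j ∈ P, (K j)ᶜ) (hK i)
    rw [h2, ih, ih] at h3
    rw [h1, Finset.sum_powerset_insert hi, eq_sub_iff_add_eq'.2 h3, sub_eq_add_neg,
      ← Finset.sum_neg_distrib]
    congr 1
    refine Finset.sum_congr rfl fun T hT => ?_
    have hiT : i ∉ T := fun h => hi (Finset.mem_powerset.1 hT h)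
    rw [Finset.card_insert_of_notMem hiT, Finset.set_biInter_insert, ← Set.inter_assoc]
    ring

/-- The alternating sums that inclusion-exclusion produces from a product measure that is
modified by a factor `1 + ε` on the sets containing `T₀`. -/
theorem sum_powerset_prod {ι : Type*} [DecidableEq ι] (P T₀ : Finset ι) (c : ι → ℝ) (ε : ℝ) :
    ∑ T ∈ P.powerset, (-1) ^ T.card * ((1 + if T₀ ⊆ T then ε else 0) * ∏ i ∈ T, c i) =
      ∏ i ∈ P, (1 - c i) + if T₀ ⊆ P then ε * ((∏ i ∈ T₀, -c i) * ∏ i ∈ P \ T₀, (1 - c i)) else 0 := by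
  have hneg : ∀ T : Finset ι, ∏ i ∈ T, -c i = (-1) ^ T.card * ∏ i ∈ T, c i := fun T => by
    rw [Finset.prod_neg]
  have h1 : ∏ i ∈ P, (1 - c i) = ∑ T ∈ P.powerset, ∏ i ∈ T, -c i := by
    simp_rw [sub_eq_neg_add]
    rw [Finset.prod_add]
    simp
  have h2 : (if T₀ ⊆ P then (∏ i ∈ T₀, -c i) * ∏ i ∈ P \ T₀, (1 - c i) else 0) =
      ∑ T ∈ P.powerset, if T₀ ⊆ T then ∏ i ∈ T, -c i else 0 := by
    split_ifs with hP
    · have h3 : (∏ i ∈ T₀, -c i) * ∏ i ∈ P \ T₀, (1 - c i) =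
          ∏ i ∈ P, (-c i + if i ∈ T₀ then 0 else 1) := by
        rw [← Finset.prod_sdiff hP, mul_comm]
        congr 1
        · refine Finset.prod_congr rfl fun i hi => ?_
          rw [if_neg (Finset.mem_sdiff.1 hi).2]
          ring
        · refine Finset.prod_congr rfl fun i hi => ?_
          rw [if_pos hi, add_zero]
      rw [h3, Finset.prod_add]
      refine Finset.sum_congr rfl fun T hT => ?_
      split_ifs with hT₀
      · have h4 : ∏ i ∈ P \ T, (if i ∈ T₀ then (0 : ℝ) else 1) = 1 :=
          Finset.prod_eq_one fun i hi => if_neg fun h => (Finset.mem_sdiff.1 hi).2 (hT₀ h)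
        rw [h4, mul_one]
      · obtain ⟨i, hi, hiT⟩ := Finset.not_subset.1 hT₀
        have h4 : ∏ i ∈ P \ T, (if i ∈ T₀ then (0 : ℝ) else 1) = 0 :=
          Finset.prod_eq_zero (Finset.mem_sdiff.2 ⟨hP hi, hiT⟩) (if_pos hi)
        rw [h4, mul_zero]
    · refine (Finset.sum_eq_zero fun T hT => ?_).symm
      rw [if_neg fun h => hP (h.trans (Finset.mem_powerset.1 hT))]
  rw [← mul_ite_zero, h1, h2, Finset.mul_sum, ← Finset.sum_add_distrib]
  refine Finset.sum_congr rfl fun T _ => ?_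
  rw [hneg]
  split_ifs <;> ring

theorem tendsto_measureReal_inter_artinSet {B : Set (A r)} (hB : MeasurableSet B) :
    Filter.Tendsto
      (fun P : Finset Nat.Primes => (nu r).real (B ∩ ⋂ p ∈ P, (radFixer r p : Set (A r))ᶜ))
      Filter.atTop (nhds ((nu r).real (B ∩ artinSet r))) := by
  have h1 : B ∩ artinSet r =
      ⋂ P : Finset Nat.Primes, (B ∩ ⋂ p ∈ P, (radFixer r p : Set (A r))ᶜ) := by
    rw [artinSet_eq]
    ext a
    simp only [Set.mem_inter_iff, Set.mem_iInter]
    constructor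
    · exact fun h P => ⟨h.1, fun p _ => h.2 p⟩
    · exact fun h => ⟨(h ∅).1, fun p => (h {p}).2 p (Finset.mem_singleton_self p)⟩
  rw [h1]
  refine (ENNReal.tendsto_toReal (measure_ne_top _ _)).comp
    (tendsto_measure_iInter_atTop (fun P => ?_) ?_ ⟨∅, measure_ne_top _ _⟩)
  · exact (hB.inter (P.measurableSet_biInter fun p _ =>
      (measurableSet_radFixer p).compl)).nullMeasurableSet
  · intro P Q hPQ
    exact Set.inter_subset_inter_right _ (Set.biInter_subset_biInter_left hPQ)

/-! ### The measures of the Artin set and of its intersection with the Galois group -/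

theorem finrank_F_ne_zero {p : ℕ} (hp : 0 < p) : Module.finrank ℚ (F r p) ≠ 0 := by
  have := finiteDimensional_F (r := r) hp
  exact Module.finrank_pos.ne'

theorem index_finsetFixer_ne_zero (hr : (r : ℚ) ≠ -1) (hsq : ¬ IsSquare (r : ℚ))
    (T : Finset Nat.Primes) : (finsetFixer r T).index ≠ 0 := by
  rw [index_finsetFixer]
  refine Finset.prod_ne_zero_iff.2 fun p _ => ?_
  rw [index_radFixer hr hsq]
  exact finrank_F_ne_zero p.2.pos

/-- The groups `A_p` are independent: `ν` of the stabilizer of `R_p` for `p ∈ T` is a product. -/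
theorem nu_real_finsetFixer (hr : (r : ℚ) ≠ -1) (hsq : ¬ IsSquare (r : ℚ))
    (T : Finset Nat.Primes) :
    (nu r).real (⋂ p ∈ T, (radFixer r p : Set (A r))) =
      ∏ p ∈ T, 1 / (Module.finrank ℚ (F r p) : ℝ) := by
  rw [← coe_finsetFixer, nu_real_subgroup _ (index_finsetFixer_ne_zero hr hsq T)
    (measurableSet_finsetFixer T), index_finsetFixer, Nat.cast_prod, Finset.prod_div_distrib,
    Finset.prod_const_one]
  simp_rw [index_radFixer hr hsq]

theorem G_index_ne_zero (hr : (r : ℚ) ≠ -1) (hsq : ¬ IsSquare (r : ℚ)) : (G r).index ≠ 0 := by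
  have hr1 : (r : ℚ) ≠ 1 := fun h => hsq ⟨1, by rw [h, one_mul]⟩
  rcases G_index hr1 hr with h | h <;> rw [h] <;> norm_num

theorem nu_real_G_inter_finsetFixer (hr : (r : ℚ) ≠ -1) (hsq : ¬ IsSquare (r : ℚ))
    (T : Finset Nat.Primes) :
    (nu r).real ((G r : Set (A r)) ∩ ⋂ p ∈ T, (radFixer r p : Set (A r))) =
      (nu r).real (G r : Set (A r)) * ((G r ⊔ finsetFixer r T).index *
        ∏ p ∈ T, 1 / (Module.finrank ℚ (F r p) : ℝ)) := by
  have hG0 := G_index_ne_zero hr hsq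
  have hT0 := index_finsetFixer_ne_zero hr hsq T
  have hGmeas := (isClosed_G r).measurableSet
  have h1 : (finsetFixer r T).relIndex (G r) * (G r).index = (G r ⊓ finsetFixer r T).index := by
    rw [← Subgroup.inf_relIndex_left, Subgroup.relIndex_mul_index inf_le_left]
  have h2 : (finsetFixer r T).relIndex (G r) * (G r ⊔ finsetFixer r T).index =
      (finsetFixer r T).index := by
    rw [← Subgroup.relIndex_sup_right, Subgroup.relIndex_mul_index le_sup_right]
  have hrel0 : (finsetFixer r T).relIndex (G r) ≠ 0 := left_ne_zero_of_mul (h2.trans_ne hT0)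
  have hsup0 : (G r ⊔ finsetFixer r T).index ≠ 0 := right_ne_zero_of_mul (h2.trans_ne hT0)
  have hinf0 : (G r ⊓ finsetFixer r T).index ≠ 0 := h1 ▸ mul_ne_zero hrel0 hG0
  rw [← nu_real_finsetFixer hr hsq, ← coe_finsetFixer, ← Subgroup.coe_inf,
    nu_real_subgroup _ hinf0 (by
      rw [Subgroup.coe_inf]
      exact hGmeas.inter (measurableSet_finsetFixer T)),
    nu_real_subgroup _ hG0 hGmeas, nu_real_subgroup _ hT0 (measurableSet_finsetFixer T), ← h1, ← h2]
  have a1 : ((finsetFixer r T).relIndex (G r) : ℝ) ≠ 0 := by exact_mod_cast hrel0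
  have a2 : ((G r ⊔ finsetFixer r T).index : ℝ) ≠ 0 := by exact_mod_cast hsup0
  have a3 : ((G r).index : ℝ) ≠ 0 := by exact_mod_cast hG0
  push_cast
  field_simp

/-- The Artin product converges to the measure of the Artin set. -/
theorem hasProd_artinSet (hr : (r : ℚ) ≠ -1) (hsq : ¬ IsSquare (r : ℚ)) :
    HasProd (fun p : Nat.Primes => 1 - 1 / (Module.finrank ℚ (F r p) : ℝ))
      ((nu r).real (artinSet r)) := by
  classical
  have h := tendsto_measureReal_inter_artinSet (r := r) MeasurableSet.univ
  rw [Set.univ_inter] at h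
  refine h.congr fun P => ?_
  rw [measureReal_inter_biInter_compl _ fun p : Nat.Primes => measurableSet_radFixer (p : ℕ)]
  simp_rw [Set.univ_inter, nu_real_finsetFixer hr hsq]
  simpa using sum_powerset_prod P ∅ (fun p : Nat.Primes => 1 / (Module.finrank ℚ (F r p) : ℝ)) 0

/-- The prime divisors of `n`, as a finite set in the type of primes. -/
def primeDivisors (n : ℕ) : Finset Nat.Primes := n.primeFactors.subtype Nat.Prime

theorem mem_primeDivisors {n : ℕ} {p : Nat.Primes} :
    p ∈ primeDivisors n ↔ (p : ℕ) ∈ n.primeFactors := Finset.mem_subtype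

theorem prod_primeDivisors (n : ℕ) (f : ℕ → ℝ) :
    ∏ p ∈ primeDivisors n, f p = ∏ p ∈ n.primeFactors, f p :=
  Finset.prod_subtype_of_mem f fun _ hp => Nat.prime_of_mem_primeFactors hp

/-- The primes `2` and `p ∣ D`. -/
def criticalPrimes (r : ℚˣ) : Finset Nat.Primes := insert primeTwo (primeDivisors (disc r).natAbs)

theorem isEntangled_iff {T : Finset Nat.Primes} :
    IsEntangled r T ↔ Odd (disc r) ∧ criticalPrimes r ⊆ T := by
  rw [IsEntangled, criticalPrimes, Finset.insert_subset_iff]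
  refine and_congr_right fun _ => and_congr_right fun _ => forall_congr' fun p => ?_
  rw [mem_primeDivisors, Nat.mem_primeFactors]
  have h0 : (disc r).natAbs ≠ 0 := Int.natAbs_ne_zero.2 (disc_ne_zero r)
  exact ⟨fun h hp => h hp.2.1, fun h hp => h ⟨p.2, hp, h0⟩⟩

theorem prod_criticalPrimes (hsq : ¬ IsSquare (r : ℚ)) (hD : Odd (disc r)) :
    ∏ p ∈ criticalPrimes r, (-1) / ((Module.finrank ℚ (F r p) : ℝ) - 1) =
      - ∏ p ∈ (disc r).natAbs.primeFactors, (-1) / ((Module.finrank ℚ (F r p) : ℝ) - 1) := by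
  have h2 : primeTwo ∉ primeDivisors (disc r).natAbs := by
    rw [mem_primeDivisors]
    intro h
    exact absurd (Odd.of_dvd_nat (Int.natAbs_odd.2 hD) (Nat.dvd_of_mem_primeFactors h)) (by decide)
  rw [criticalPrimes, Finset.prod_insert h2, finrank_F_two hsq,
    prod_primeDivisors _ fun p => (-1) / ((Module.finrank ℚ (F r p) : ℝ) - 1)]
  norm_num

theorem density_artinSet (hr : (r : ℚ) ≠ -1) (hsq : ¬ IsSquare (r : ℚ)) :
    density r (artinSet r) = correctionFactor r * artinConstant r := by
  classical
  set c : Nat.Primes → ℝ := fun p => 1 / (Module.finrank ℚ (F r p) : ℝ) with hc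
  have hprod := hasProd_artinSet hr hsq
  have hA : artinConstant r = (nu r).real (artinSet r) := hprod.tprod_eq
  set ε : ℝ := if Odd (disc r) then 1 else 0 with hε
  have hindex : ∀ T : Finset Nat.Primes, ((G r ⊔ finsetFixer r T).index : ℝ) =
      1 + if criticalPrimes r ⊆ T then ε else 0 := by
    intro T
    by_cases hT : IsEntangled r T
    · obtain ⟨hD, hcT⟩ := isEntangled_iff.1 hT
      rw [index_G_sup_finsetFixer hr hsq hT, if_pos hcT, hε, if_pos hD]
      norm_num
    · rw [G_sup_finsetFixer hr hsq hT, Subgroup.index_top]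
      have := fun hD hcT => hT (isEntangled_iff.2 ⟨hD, hcT⟩)
      rw [hε]
      split_ifs with h1 h2
      · exact absurd h1 (this h2)
      all_goals norm_num
  have hfinite : ∀ P : Finset Nat.Primes, criticalPrimes r ⊆ P →
      (nu r).real ((G r : Set (A r)) ∩ ⋂ p ∈ P, (radFixer r p : Set (A r))ᶜ) =
        (nu r).real (G r : Set (A r)) * (correctionFactor r * ∏ p ∈ P, (1 - c p)) := by
    intro P hP
    rw [measureReal_inter_biInter_compl _ fun p : Nat.Primes => measurableSet_radFixer (p : ℕ)]
    simp_rw [nu_real_G_inter_finsetFixer hr hsq, hindex]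
    simp_rw [mul_left_comm _ ((nu r).real (G r : Set (A r)))]
    rw [← Finset.mul_sum, sum_powerset_prod P (criticalPrimes r) c ε, if_pos hP]
    congr 1
    -- for `c = 1 / f` one has `-c / (1 - c) = -1 / (f - 1)`
    have hsplit : (∏ p ∈ criticalPrimes r, -c p) * ∏ p ∈ P \ criticalPrimes r, (1 - c p) =
        (∏ p ∈ criticalPrimes r, (-1) / ((Module.finrank ℚ (F r p) : ℝ) - 1)) *
          ∏ p ∈ P, (1 - c p) := by
      rw [← Finset.prod_sdiff hP, mul_comm (∏ p ∈ P \ criticalPrimes r, (1 - c p)), ← mul_assoc,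
        ← Finset.prod_mul_distrib]
      congr 1
      refine Finset.prod_congr rfl fun p _ => ?_
      have h1 : (1 : ℝ) < Module.finrank ℚ (F r p) := by exact_mod_cast one_lt_finrank_F hsq p.2
      have h2 : (Module.finrank ℚ (F r p) : ℝ) - 1 ≠ 0 := by linarith
      have h3 : (Module.finrank ℚ (F r p) : ℝ) ≠ 0 := by linarith
      simp only [hc]
      field_simp
    rw [hsplit]
    by_cases hD : Odd (disc r)
    · rw [correctionFactor, if_neg (Int.not_even_iff_odd.2 hD), hε, if_pos hD,
        prod_criticalPrimes hsq hD]
      ring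
    · rw [correctionFactor, if_pos (Int.not_odd_iff_even.1 hD), hε, if_neg hD]
      ring
  have hlim := tendsto_measureReal_inter_artinSet (isClosed_G r).measurableSet
  have hlim' : Filter.Tendsto
      (fun P : Finset Nat.Primes => (nu r).real ((G r : Set (A r)) ∩ ⋂ p ∈ P,
        (radFixer r p : Set (A r))ᶜ)) Filter.atTop
      (nhds ((nu r).real (G r : Set (A r)) * (correctionFactor r * (nu r).real (artinSet r)))) := by
    have h := (Filter.Tendsto.const_mul (correctionFactor r) hprod).const_mul
      ((nu r).real (G r : Set (A r)))
    refine h.congr' ?_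
    filter_upwards [Filter.eventually_ge_atTop (criticalPrimes r)] with P hP
    exact (hfinite P hP).symm
  rw [density, tendsto_nhds_unique hlim hlim', hA]
  refine mul_div_cancel_left₀ _ ?_
  have hG0 := G_index_ne_zero hr hsq
  rw [nu_real_subgroup _ hG0 (isClosed_G r).measurableSet]
  positivity

/-! ### The explicit products -/

theorem multipliable_artin (h : ℕ) :
    Multipliable (fun p : {p : ℕ // p.Prime ∧ ¬ p ∣ h} => 1 - 1 / ((p : ℝ) * ((p : ℝ) - 1))) := by
  have hsum : Summable (fun p : {p : ℕ // p.Prime ∧ ¬ p ∣ h} => -(1 / ((p : ℝ) * ((p : ℝ) - 1)))) := by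
    refine Summable.neg ?_
    have h2 : Summable fun n : ℕ => 2 * (1 / (n : ℝ) ^ 2) :=
      (Real.summable_one_div_nat_pow.2 one_lt_two).mul_left 2
    refine Summable.of_nonneg_of_le (fun p => ?_) (fun p => ?_)
      (h2.comp_injective (Subtype.val_injective (p := fun p : ℕ => p.Prime ∧ ¬ p ∣ h)))
    all_goals have hp : (2 : ℝ) ≤ (p : ℕ) := by exact_mod_cast p.2.1.two_le
    · exact div_nonneg zero_le_one (mul_nonneg (by linarith) (by linarith))
    · change 1 / ((p : ℝ) * ((p : ℝ) - 1)) ≤ 2 * (1 / ((p : ℕ) : ℝ) ^ 2)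
      rw [mul_one_div, div_le_div_iff₀ (by nlinarith) (by nlinarith)]
      nlinarith
  simpa only [sub_eq_add_neg] using Real.multipliable_one_add_of_summable hsum

theorem artinConstant_eq {h : ℕ}
    (hh : IsGreatest {k : ℕ | ∃ s : ℚ, s ^ k = r} h) :
    artinConstant r = (∏ p ∈ h.primeFactors, (1 - 1 / ((p : ℝ) - 1))) *
      ∏' p : {p : ℕ // p.Prime ∧ ¬ p ∣ h}, (1 - 1 / ((p : ℝ) * ((p : ℝ) - 1))) := by
  have hh1 : 1 ≤ h := hh.2 ⟨(r : ℚ), pow_one _⟩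
  have hh0 : h ≠ 0 := by omega
  let f : ℕ → ℝ := fun p => 1 - 1 / (Module.finrank ℚ (F r p) : ℝ)
  let t : Set ℕ := {p | p.Prime ∧ ¬ p ∣ h}
  have h1 : HasProd (f ∘ (↑) : ↥(h.primeFactors : Set ℕ) → ℝ)
      (∏ p ∈ h.primeFactors, (1 - 1 / ((p : ℝ) - 1))) := by
    rw [Finset.prod_congr rfl (g := f)]
    · exact h.primeFactors.hasProd f
    · intro p hp
      simp only [f]
      rw [finrank_F_of_dvd hh (Nat.prime_of_mem_primeFactors hp) (Nat.dvd_of_mem_primeFactors hp)]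
  have h2 : HasProd (f ∘ (↑) : t → ℝ)
      (∏' p : {p : ℕ // p.Prime ∧ ¬ p ∣ h}, (1 - 1 / ((p : ℝ) * ((p : ℝ) - 1)))) := by
    have : (f ∘ (↑) : t → ℝ) =
        fun p : t => 1 - 1 / (((p : ℕ) : ℝ) * (((p : ℕ) : ℝ) - 1)) := by
      funext p
      simp only [f, Function.comp_apply]
      rw [finrank_F_of_not_dvd hh p.2.1 p.2.2]
    rw [this]
    exact (multipliable_artin h).hasProd
  have hdisj : Disjoint (h.primeFactors : Set ℕ) t := Set.disjoint_left.2 fun p hp hpt =>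
    hpt.2 (Nat.dvd_of_mem_primeFactors hp)
  have hunion : (h.primeFactors : Set ℕ) ∪ t = {p | p.Prime} := by
    ext p
    simp only [Set.mem_union, Finset.mem_coe, Nat.mem_primeFactors, t, Set.mem_ofPred_eq]
    tauto
  have h3 := h1.mul_disjoint hdisj h2
  rw [hunion] at h3
  exact h3.tprod_eq

theorem correctionFactor_eq (hD : Odd (disc r)) {h : ℕ}
    (hh : IsGreatest {k : ℕ | ∃ s : ℚ, s ^ k = r} h) :
    correctionFactor r =
      1 - (∏ p ∈ (disc r).natAbs.primeFactors with p ∣ h, (-1) / ((p : ℝ) - 2)) *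
        ∏ p ∈ (disc r).natAbs.primeFactors with ¬ p ∣ h, (-1) / ((p : ℝ) ^ 2 - (p : ℝ) - 1) := by
  rw [correctionFactor, if_neg (Int.not_even_iff_odd.2 hD),
    ← Finset.prod_filter_mul_prod_filter_not _ (fun p => p ∣ h)]
  congr 2
  · refine Finset.prod_congr rfl fun p hp => ?_
    rw [Finset.mem_filter] at hp
    rw [finrank_F_of_dvd hh (Nat.prime_of_mem_primeFactors hp.1) hp.2]
    ring
  · refine Finset.prod_congr rfl fun p hp => ?_
    rw [Finset.mem_filter] at hp
    rw [finrank_F_of_not_dvd hh (Nat.prime_of_mem_primeFactors hp.1) hp.2]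
    ring

end ArtinEntanglement

end

open ArtinEntanglement in
theorem theorem4p2 (r : ℚˣ) (hr : (r : ℚ) ≠ -1) (hsq : ¬ IsSquare (r : ℚ)) :
    -- `ν(S) = A(r)`, where the infinite product defining `A(r)` converges
    Multipliable (fun p : Nat.Primes => 1 - 1 / (Module.finrank ℚ (F r p) : ℝ)) ∧
    (nu r).real (artinSet r) = artinConstant r ∧
    -- `δ(S) = E(r) · A(r)`
    density r (artinSet r) = correctionFactor r * artinConstant r ∧
    -- the explicit values of `A(r)` and `E(r)`, with `h` the largest integer
    -- such that `r` is an `h`-th power in `ℚ*`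
    ∃ h : ℕ, IsGreatest {k : ℕ | ∃ s : ℚ, s ^ k = r} h ∧
      Multipliable (fun p : {p : ℕ // p.Prime ∧ ¬ p ∣ h} => 1 - 1 / ((p : ℝ) * ((p : ℝ) - 1))) ∧
      artinConstant r = (∏ p ∈ h.primeFactors, (1 - 1 / ((p : ℝ) - 1))) *
        ∏' p : {p : ℕ // p.Prime ∧ ¬ p ∣ h}, (1 - 1 / ((p : ℝ) * ((p : ℝ) - 1))) ∧
      (Odd (disc r) → correctionFactor r =
        1 - (∏ p ∈ (disc r).natAbs.primeFactors with p ∣ h, (-1) / ((p : ℝ) - 2)) *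
          ∏ p ∈ (disc r).natAbs.primeFactors with ¬ p ∣ h, (-1) / ((p : ℝ) ^ 2 - (p : ℝ) - 1)) := by
  have hprod := hasProd_artinSet hr hsq
  obtain ⟨h, hh⟩ := exists_isGreatest_exponent hr hsq
  exact ⟨hprod.multipliable, hprod.tprod_eq.symm, density_artinSet hr hsq, h, hh,
    multipliable_artin h, artinConstant_eq hh, fun hD => correctionFactor_eq hD hh⟩
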